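/- Notation. Let $A_0,A_1$ be real $2\times 2$ matrices. For $\alpha\ge 0$ put $A_0^{(\alpha)}=A_0$, $A_1^{(\alpha)}=\alpha A_1$. For a finite word $u=u_1\cdots u_m$ over $\{0,1\}$ put $\mathcal A_\alpha(u)=A^{(\alpha)}_{u_m}\cdots A^{(\alpha)}_{u_1}$ and $\mathcal A(u)=\mathcal A_1(u)$. Let $\rho$ denote the spectral radius, and let $\varrho(\alpha)=\lim_{n\to\infty}\max_{|u|=n}\|\mathcal A_\alpha(u)\|^{1/n}$ be the joint spectral radius of $\{A_0,\alpha A_1\}$. An infinite word $x\in\{0,1\}^{\mathbb N}$ is weakly extremal for $\alpha$ if $\|\mathcal A_\alpha(x_1\cdots x_n)\|^{1/n}\to\varrho(\alpha)$ as $n\to\infty$. A finite word is balanced if any two of its subwords (blocks of consecutive letters) of equal length have numbers of $1$s that differ by at most one, and cyclically balanced if all its cyclic permutations are balanced. For $\gamma\in[0,1]$ let $X_\gamma$ be the set of infinite words $x$ such that for some $\delta\in\mathbb R$ either $x_n=\lfloor\gamma(n+1)+\delta\rfloor-\lfloor\gamma n+\delta\rfloor$ for all $n$, or $x_n=\lceil\gamma(n+1)+\delta\rceil-\lceil\gamma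 n+\delta\rceil$ for all $n$. Hypotheses. Suppose that $A_0$ and $A_1$ are non-negative and invertible, have positive trace, and have no common invariant subspace other than $\{0\}$ and $\mathbb R^2$, and that all entries of $\mathcal A(u)$ are positive for every finite word $u$ which is not of the form $0^n$ or $1^n$. Suppose further that $\mathfrak r\colon[0,\infty)\to[0,1]$ is a function (the $1$-ratio function of the pair) such that for every $\alpha\ge 0$: every $x\in X_{\mathfrak r(\alpha)}$ is weakly extremal for $\alpha$; if $x\in\{0,1\}^{\mathbb N}$ is weakly extremal for $\alpha$, then $\frac1n\#\{1\le i\le n: x_i=1\}\to\mathfrak r(\alpha)$; and $\rho(\mathcal A_\alpha(u))<\varrho(\alpha)^{|u|}$ for every finite word $u$ which is not cyclically balanced. Statement. Let $L\subset(0,1)$ be compact. Then there exist constants $C>1$ and $\theta\in(0,1)$ such that for every $p/q\in L$ with $p$ and $q\geq 1$ coprime, the set $\mathfrak r^{-1}(p/q)$ is a nonempty closed bounded interval whose length is at most $C\,q\,\theta^q$. -/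

import Mathlib

open Filter Topology
open scoped NNReal Matrix.Norms.L2Operator

/-- Real `2 × 2` matrices. The norm in force is the operator norm induced by the Euclidean norm. -/
abbrev Mat2 : Type := Matrix (Fin 2) (Fin 2) ℝ

/-- Finite words over the alphabet `{0, 1}`. -/
abbrev FinWord : Type := List (Fin 2)

/-- Infinite words over `{0, 1}`; `x i` is the letter number `i + 1` of the word. -/
abbrev InfWord : Type := ℕ → Fin 2

/-- The prefix of length `n` of an infinite word. -/
def initialWord (x : InfWord) (n : ℕ) : FinWord := List.ofFn fun i : Fin n => x i

/-- For `u = u₁ ⋯ uₘ`, the product `B_{uₘ} ⋯ B_{u₁}`; note the reversed order. -/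
def wordProd (B : Fin 2 → Mat2) (u : FinWord) : Mat2 := (u.reverse.map B).prod

/-- The pair `𝖠_α = {A₀, α A₁}`. -/
def scaledPair (A : Fin 2 → Mat2) (α : ℝ) : Fin 2 → Mat2 := ![A 0, α • A 1]

/-- The spectral radius of a real matrix: the largest modulus of a complex eigenvalue. -/
noncomputable def specRad (M : Mat2) : ℝ :=
  (spectralRadius ℂ (M.map (algebraMap ℝ ℂ))).toReal

/-- The joint spectral radius of the pair `{B₀, B₁}`: the limit (which always exists) of the
maximum of `‖B_{iₙ} ⋯ B_{i₁}‖ ^ (1 / n)` over all words of length `n`. -/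
noncomputable def jointSpecRad (B : Fin 2 → Mat2) : ℝ :=
  limUnder atTop fun n : ℕ =>
    ⨆ w : Fin n → Fin 2, ‖wordProd B (List.ofFn w)‖ ^ (1 / (n : ℝ))

/-- `x` is weakly extremal for the pair `{B₀, B₁}`. -/
def WeaklyExtremal (B : Fin 2 → Mat2) (x : InfWord) : Prop :=
  Tendsto (fun n : ℕ => ‖wordProd B (initialWord x n)‖ ^ (1 / (n : ℝ))) atTop
    (𝓝 (jointSpecRad B))

/-- The proportion of letters equal to `1` in the prefixes of `x` tends to `γ`. -/
def HasOneFrequency (x : InfWord) (γ : ℝ) : Prop :=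
  Tendsto (fun n : ℕ => ((initialWord x n).count 1 : ℝ) / (n : ℝ)) atTop (𝓝 γ)

/-- A finite word is balanced if the numbers of `1`s in any two of its subwords (contiguous blocks)
of equal length differ by at most one. -/
def IsBalanced (u : FinWord) : Prop :=
  ∀ v w : FinWord, v <:+: u → w <:+: u → v.length = w.length →
    |(v.count 1 : ℤ) - (w.count 1 : ℤ)| ≤ 1

/-- A finite word is cyclically balanced if all its cyclic permutations, itself included,
are balanced. -/
def IsCyclicallyBalanced (u : FinWord) : Prop :=
  ∀ v : FinWord, v ~r u → IsBalanced v

/-- The set `X_γ` of Sturmian infinite words of slope `γ`. As the offset `δ` is arbitrary, it does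
not matter whether the letters are numbered from `0` or from `1`. -/
def SturmianWords (γ : ℝ) : Set InfWord :=
  {x | ∃ δ : ℝ,
    (∀ n : ℕ, ((x n : ℕ) : ℤ) = ⌊γ * ((n : ℝ) + 1) + δ⌋ - ⌊γ * (n : ℝ) + δ⌋) ∨
    (∀ n : ℕ, ((x n : ℕ) : ℤ) = ⌈γ * ((n : ℝ) + 1) + δ⌉ - ⌈γ * (n : ℝ) + δ⌉)}

/-- The technical hypotheses on a pair `{A₀, A₁}` of real `2 × 2` matrices. -/
structure TechnicalHypotheses (A : Fin 2 → Mat2) : Prop where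
  nonneg : ∀ k i j, 0 ≤ A k i j
  invertible : ∀ k, IsUnit (A k)
  trace_pos : ∀ k, 0 < (A k).trace
  no_common_invariant_subspace : ∀ W : Submodule ℝ (Fin 2 → ℝ),
    (∀ k, ∀ v ∈ W, (A k).mulVec v ∈ W) → W = ⊥ ∨ W = ⊤
  mixed_pos : ∀ u : FinWord, (∀ n : ℕ, u ≠ List.replicate n 0) →
    (∀ n : ℕ, u ≠ List.replicate n 1) → ∀ i j, 0 < wordProd A u i j

/-- `r : [0, ∞) → [0, 1]` witnesses the Sturmian hypothesis for the pair `A`, that is,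
`r` is the 1-ratio function of `A` (it is unique by `frequency`). -/
structure IsOneRatioFunction (A : Fin 2 → Mat2) (r : ℝ≥0 → Set.Icc (0 : ℝ) 1) : Prop where
  extremal : ∀ α : ℝ≥0, ∀ x ∈ SturmianWords (r α), WeaklyExtremal (scaledPair A α) x
  frequency : ∀ (α : ℝ≥0) (x : InfWord), WeaklyExtremal (scaledPair A α) x →
    HasOneFrequency x (r α)
  strict : ∀ (α : ℝ≥0) (u : FinWord), ¬ IsCyclicallyBalanced u →
    specRad (wordProd (scaledPair A α) u) < jointSpecRad (scaledPair A α) ^ u.length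

/-! Write ϱ(α) for the joint spectral radius. Evaluating an extremal word for α at the parameter β
gives ϱ(β) ≥ (β/α)^r(α) ϱ(α) (`rpow_mul_jointSpecRad_le`): r(α) is a subgradient of log ϱ as a
function of log α, so r is monotone. Sublevel and superlevel sets of r are closed, because suitable
shifts of extremal words at nearby parameters accumulate on a weakly extremal word that inherits
their letter counts. Since r(0) = 0 and r is eventually above any γ < 1, connectedness of [0, ∞)
makes each level set in question a compact interval [a, b] (`exists_eq_Icc`).

For the length, let U be a period of a rotation word of slope p/q, K = 𝒜(U), and let l, v, w be the
Perron eigenvalue and the right and left eigenvectors of K. If r(α) = p/q then ϱ(α)^q ≤ l α^p.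
Inserting a word T into a long repetition of U cannot beat ϱ(α), so with κ_T = (w · 𝒜(T)v)/(w · v)
one gets (α^(number of 1s in T) κ_T)^q ≤ (l α^p)^|T| (`pow_mul_dotProduct_le`). The net exponent of
α is q·#1(T) − p|T|. The factorization U = TT' chosen by Bézout has exponent +1 for T and −1 for T':
T bounds b from above, T' bounds a from below, and b (κκ')^q ≤ a l^q.

It remains to see that l/(κκ') is exponentially close to 1. With M = 𝒜(T) and M' = 𝒜(T') it is the
cross ratio of the covectors w, wM' and the vectors v, Mv. These covectors are left eigenvectors of
𝒜(TT') and 𝒜(T'T), and the words TT' and T'T share their first q − 2 letters. Hence both covectors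
lie in the image of the nonnegative cone under a long common product, whose ratio |det|/perm is
exponentially small: that ratio is submultiplicative on nonnegative matrices, and every block of
bounded length contains both letters, uniformly for p/q in L (`mul_pow_le`). -/

/-! ### Words -/

/-- The infinite word obtained by deleting the first `m` letters. -/
def shiftWord (m : ℕ) (x : InfWord) : InfWord := fun i => x (m + i)

theorem length_initialWord (x : InfWord) (n : ℕ) : (initialWord x n).length = n := by
  simp [initialWord]

theorem initialWord_zero (x : InfWord) : initialWord x 0 = [] := by
  simp [initialWord]

theorem initialWord_add (x : InfWord) (m n : ℕ) :
    initialWord x (m + n) = initialWord x m ++ initialWord (shiftWord m x) n := by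
  simp [initialWord, List.ofFn_add, shiftWord]

theorem initialWord_succ (x : InfWord) (n : ℕ) :
    initialWord x (n + 1) = initialWord x n ++ [x n] := by
  rw [initialWord_add]
  simp [initialWord, shiftWord]

theorem initialWord_congr {x y : InfWord} {n : ℕ} (h : ∀ i < n, x i = y i) :
    initialWord x n = initialWord y n := by
  unfold initialWord
  congr 1
  funext i
  exact h i i.2

theorem shiftWord_shiftWord (m n : ℕ) (x : InfWord) :
    shiftWord n (shiftWord m x) = shiftWord (m + n) x := by
  funext i
  simp [shiftWord, add_assoc]

theorem wordProd_nil (B : Fin 2 → Mat2) : wordProd B [] = 1 := by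
  simp [wordProd]

theorem wordProd_append (B : Fin 2 → Mat2) (u v : FinWord) :
    wordProd B (u ++ v) = wordProd B v * wordProd B u := by
  simp [wordProd]

theorem wordProd_singleton (B : Fin 2 → Mat2) (k : Fin 2) : wordProd B [k] = B k := by
  simp [wordProd]

theorem wordProd_replicate (B : Fin 2 → Mat2) (k : Fin 2) (n : ℕ) :
    wordProd B (List.replicate n k) = B k ^ n := by
  simp [wordProd]

theorem wordProd_nonneg {B : Fin 2 → Mat2} (hB : ∀ k i j, 0 ≤ B k i j) (u : FinWord) (i j : Fin 2) :
    0 ≤ wordProd B u i j := by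
  induction u generalizing i j with
  | nil =>
    rw [wordProd_nil, Matrix.one_apply]
    split <;> norm_num
  | cons k u ih =>
    rw [← List.singleton_append, wordProd_append, wordProd_singleton, Matrix.mul_apply]
    exact Finset.sum_nonneg fun l _ => mul_nonneg (ih i l) (hB k l j)

theorem wordProd_scaledPair (A : Fin 2 → Mat2) (α : ℝ) (u : FinWord) :
    wordProd (scaledPair A α) u = α ^ u.count 1 • wordProd A u := by
  induction u with
  | nil => simp [wordProd_nil]
  | cons k u ih =>
    rw [← List.singleton_append, wordProd_append, wordProd_append, ih, wordProd_singleton,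
      wordProd_singleton]
    fin_cases k
    · simp [scaledPair]
    · simp [scaledPair, pow_succ, smul_smul, mul_comm α]

theorem norm_wordProd_scaledPair (A : Fin 2 → Mat2) {α : ℝ} (hα : 0 ≤ α) (u : FinWord) :
    ‖wordProd (scaledPair A α) u‖ = α ^ u.count 1 * ‖wordProd A u‖ := by
  rw [wordProd_scaledPair, norm_smul, Real.norm_of_nonneg (pow_nonneg hα _)]

theorem norm_wordProd_append_le (B : Fin 2 → Mat2) (u v : FinWord) :
    ‖wordProd B (u ++ v)‖ ≤ ‖wordProd B u‖ * ‖wordProd B v‖ := by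
  rw [wordProd_append, mul_comm ‖wordProd B u‖]
  exact norm_mul_le _ _

/-! ### Matrix norms -/

theorem Matrix.abs_entry_le_l2_opNorm (M : Mat2) (i j : Fin 2) : |M i j| ≤ ‖M‖ := by
  have h := Matrix.l2_opNorm_mulVec M (EuclideanSpace.single j (1 : ℝ))
  simp only [PiLp.norm_single, norm_one, mul_one] at h
  refine le_trans ?_ h
  have h3 := PiLp.norm_apply_le (WithLp.toLp 2 (M.mulVec (EuclideanSpace.single j (1:ℝ)).ofLp)) i
  refine le_trans (le_of_eq ?_) h3
  simp

theorem Matrix.exists_l2_opNorm_le_sum :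
    ∃ C : ℝ, 0 < C ∧ ∀ M : Mat2, ‖M‖ ≤ C * ∑ i, ∑ j, |M i j| := by
  refine ⟨1 + ∑ i : Fin 2, ∑ j : Fin 2, ‖(Matrix.single i j (1 : ℝ) : Mat2)‖, by positivity, fun M => ?_⟩
  conv_lhs => rw [Matrix.matrix_eq_sum_single M]
  refine (norm_sum_le _ _).trans ?_
  rw [Finset.mul_sum]
  refine Finset.sum_le_sum fun i _ => (norm_sum_le _ _).trans ?_
  rw [Finset.mul_sum]
  refine Finset.sum_le_sum fun j _ => ?_
  have : (Matrix.single i j (M i j) : Mat2) = M i j • Matrix.single i j 1 := by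
    rw [Matrix.smul_single, smul_eq_mul, mul_one]
  rw [this, norm_smul, mul_comm, Real.norm_eq_abs]
  refine mul_le_mul_of_nonneg_right ?_ (abs_nonneg _)
  have h1 : ‖(Matrix.single i j (1 : ℝ) : Mat2)‖ ≤ ∑ j : Fin 2, ‖(Matrix.single i j (1 : ℝ) : Mat2)‖ :=
    Finset.single_le_sum (f := fun j => ‖(Matrix.single i j (1 : ℝ) : Mat2)‖)
      (fun _ _ => norm_nonneg _) (Finset.mem_univ j)
  have h2 : ∑ j : Fin 2, ‖(Matrix.single i j (1 : ℝ) : Mat2)‖ ≤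
      ∑ i : Fin 2, ∑ j : Fin 2, ‖(Matrix.single i j (1 : ℝ) : Mat2)‖ :=
    Finset.single_le_sum (f := fun i => ∑ j : Fin 2, ‖(Matrix.single i j (1 : ℝ) : Mat2)‖)
      (fun _ _ => Finset.sum_nonneg fun _ _ => norm_nonneg _) (Finset.mem_univ i)
  linarith

theorem exists_diag_pos {M : Mat2} (htr : 0 < M.trace) : ∃ i, 0 < M i i := by
  by_contra! h
  rw [Matrix.trace_fin_two] at htr
  linarith [h 0, h 1]

theorem pow_diag_le_norm_pow {M : Mat2} (hM : ∀ i j, 0 ≤ M i j) (i : Fin 2) (n : ℕ) :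
    M i i ^ n ≤ ‖M ^ n‖ := by
  have key : ∀ n, (∀ k l, 0 ≤ (M ^ n) k l) ∧ M i i ^ n ≤ (M ^ n) i i := by
    intro n
    induction n with
    | zero =>
      refine ⟨fun k l => ?_, by simp⟩
      rw [pow_zero, Matrix.one_apply]
      split <;> norm_num
    | succ n ih =>
      refine ⟨fun k l => ?_, ?_⟩
      · rw [pow_succ, Matrix.mul_apply]
        exact Finset.sum_nonneg fun j _ => mul_nonneg (ih.1 k j) (hM j l)
      · rw [pow_succ, pow_succ, Matrix.mul_apply]
        refine (mul_le_mul_of_nonneg_right ih.2 (hM i i)).trans ?_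
        exact Finset.single_le_sum (f := fun j => (M ^ n) i j * M j i)
          (fun j _ => mul_nonneg (ih.1 i j) (hM j i)) (Finset.mem_univ i)
  exact (key n).2.trans ((le_abs_self _).trans (Matrix.abs_entry_le_l2_opNorm _ _ _))

/-! ### The joint spectral radius -/

/-- The maximal norm of a product of length `n`. -/
noncomputable def maxNorm (B : Fin 2 → Mat2) (n : ℕ) : ℝ :=
  ⨆ w : Fin n → Fin 2, ‖wordProd B (List.ofFn w)‖

theorem norm_wordProd_le_maxNorm (B : Fin 2 → Mat2) (u : FinWord) :
    ‖wordProd B u‖ ≤ maxNorm B u.length := by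
  have := le_ciSup (f := fun w : Fin u.length → Fin 2 => ‖wordProd B (List.ofFn w)‖)
    (Set.finite_range _).bddAbove u.get
  simpa [maxNorm] using this

theorem exists_maxNorm_eq (B : Fin 2 → Mat2) (n : ℕ) :
    ∃ u : FinWord, u.length = n ∧ maxNorm B n = ‖wordProd B u‖ := by
  obtain ⟨w, hw⟩ := exists_eq_ciSup_of_finite
    (f := fun w : Fin n → Fin 2 => ‖wordProd B (List.ofFn w)‖)
  exact ⟨List.ofFn w, by simp, hw.symm⟩

theorem maxNorm_add_le (B : Fin 2 → Mat2) (m n : ℕ) :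
    maxNorm B (m + n) ≤ maxNorm B m * maxNorm B n := by
  obtain ⟨u, hu, h⟩ := exists_maxNorm_eq B (m + n)
  rw [h, ← List.take_append_drop m u]
  have h1 := norm_wordProd_le_maxNorm B (u.take m)
  have h2 := norm_wordProd_le_maxNorm B (u.drop m)
  rw [List.length_take, hu, min_eq_left (by omega)] at h1
  rw [List.length_drop, hu, Nat.add_sub_cancel_left] at h2
  refine (norm_wordProd_append_le _ _ _).trans ?_
  gcongr
  exact (norm_nonneg _).trans h1

theorem pow_le_maxNorm {B : Fin 2 → Mat2} {a : ℝ} (hB : ∀ n, a ^ n ≤ ‖B 0 ^ n‖) (n : ℕ) :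
    a ^ n ≤ maxNorm B n := by
  refine (hB n).trans ?_
  have := norm_wordProd_le_maxNorm B (List.replicate n 0)
  rwa [wordProd_replicate, List.length_replicate] at this

/-- Fekete's lemma for log `maxNorm`. The growth assumption on `B 0` keeps the logarithms meaningful
and bounded below linearly; for scaled pairs it comes from a positive diagonal entry of A₀ and does
not depend on α. -/
theorem exists_tendsto_maxNorm_rpow {B : Fin 2 → Mat2} {a : ℝ} (ha : 0 < a)
    (hB : ∀ n, a ^ n ≤ ‖B 0 ^ n‖) :
    ∃ l, Tendsto (fun n : ℕ => maxNorm B n ^ (1 / (n : ℝ))) atTop (𝓝 l) := by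
  have hpos : ∀ n, 0 < maxNorm B n := fun n => (pow_pos ha n).trans_le (pow_le_maxNorm hB n)
  have hsub : Subadditive fun n => Real.log (maxNorm B n) := by
    intro m n
    rw [← Real.log_mul (hpos m).ne' (hpos n).ne']
    exact Real.log_le_log (hpos _) (maxNorm_add_le B m n)
  have hbdd : BddBelow (Set.range fun n : ℕ => Real.log (maxNorm B n) / n) := by
    refine ⟨min (Real.log a) 0, ?_⟩
    rintro _ ⟨n, rfl⟩
    rcases Nat.eq_zero_or_pos n with rfl | hn
    · simp
    · refine (min_le_left _ _).trans ?_
      have hn' : (0 : ℝ) < n := by exact_mod_cast hn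
      rw [le_div_iff₀ hn', mul_comm, ← Real.log_pow]
      exact Real.log_le_log (pow_pos ha n) (pow_le_maxNorm hB n)
  refine ⟨Real.exp hsub.lim, ?_⟩
  refine ((Real.continuous_exp.tendsto _).comp (hsub.tendsto_lim hbdd)).congr fun n => ?_
  simp only [Function.comp]
  rw [Real.rpow_def_of_pos (hpos n)]
  congr 1
  ring

theorem iSup_norm_rpow_eq (B : Fin 2 → Mat2) (n : ℕ) :
    (⨆ w : Fin n → Fin 2, ‖wordProd B (List.ofFn w)‖ ^ (1 / (n : ℝ))) =
      maxNorm B n ^ (1 / (n : ℝ)) := by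
  refine le_antisymm (ciSup_le fun w => ?_) ?_
  · have := norm_wordProd_le_maxNorm B (List.ofFn w)
    rw [List.length_ofFn] at this
    exact Real.rpow_le_rpow (norm_nonneg _) this (by positivity)
  · obtain ⟨w, hw⟩ := exists_eq_ciSup_of_finite
      (f := fun w : Fin n → Fin 2 => ‖wordProd B (List.ofFn w)‖)
    rw [maxNorm, ← hw]
    exact le_ciSup (f := fun w : Fin n → Fin 2 => ‖wordProd B (List.ofFn w)‖ ^ (1 / (n : ℝ)))
      (Set.finite_range _).bddAbove w

theorem tendsto_maxNorm_rpow {B : Fin 2 → Mat2} {a : ℝ} (ha : 0 < a)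
    (hB : ∀ n, a ^ n ≤ ‖B 0 ^ n‖) :
    Tendsto (fun n : ℕ => maxNorm B n ^ (1 / (n : ℝ))) atTop (𝓝 (jointSpecRad B)) := by
  obtain ⟨l, hl⟩ := exists_tendsto_maxNorm_rpow ha hB
  have : jointSpecRad B = l := by
    unfold jointSpecRad
    simp_rw [iSup_norm_rpow_eq]
    exact hl.limUnder_eq
  rwa [this]

theorem rpow_one_div_pow_le {a y : ℝ} (ha : 0 ≤ a) {n : ℕ} (hn : 0 < n) (h : a ^ n ≤ y) :
    a ≤ y ^ (1 / (n : ℝ)) := by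
  have := Real.rpow_le_rpow (pow_nonneg ha n) h (z := 1 / (n : ℝ)) (by positivity)
  rwa [one_div, Real.pow_rpow_inv_natCast ha hn.ne', ← one_div] at this

theorem tendsto_const_rpow_one_div {c : ℝ} (hc : 0 < c) :
    Tendsto (fun n : ℕ => c ^ (1 / (n : ℝ))) atTop (𝓝 1) := by
  have h : Tendsto (fun n : ℕ => 1 / (n : ℝ)) atTop (𝓝 0) := tendsto_one_div_atTop_nhds_zero_nat
  have := (Real.continuousAt_const_rpow hc.ne' (b := 0)).tendsto.comp h
  simpa [Function.comp_def] using this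

theorem le_jointSpecRad {B : Fin 2 → Mat2} {a : ℝ} (ha : 0 < a)
    (hB : ∀ n, a ^ n ≤ ‖B 0 ^ n‖) : a ≤ jointSpecRad B := by
  refine ge_of_tendsto (tendsto_maxNorm_rpow ha hB) ?_
  filter_upwards [eventually_gt_atTop 0] with n hn
  exact rpow_one_div_pow_le ha.le hn (pow_le_maxNorm hB n)

/-- The `n`-fold repetition of a finite word. -/
def repeatWord (u : FinWord) (n : ℕ) : FinWord := (List.replicate n u).flatten

theorem repeatWord_succ (u : FinWord) (n : ℕ) : repeatWord u (n + 1) = u ++ repeatWord u n := by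
  simp [repeatWord, List.replicate_succ]

theorem length_repeatWord (u : FinWord) (n : ℕ) : (repeatWord u n).length = n * u.length := by
  simp [repeatWord]

theorem wordProd_repeatWord (B : Fin 2 → Mat2) (u : FinWord) (n : ℕ) :
    wordProd B (repeatWord u n) = wordProd B u ^ n := by
  induction n with
  | zero => simp [repeatWord, wordProd_nil]
  | succ n ih => rw [repeatWord_succ, wordProd_append, ih, pow_succ]

theorem le_jointSpecRad_pow {B : Fin 2 → Mat2} {a : ℝ} (ha : 0 < a)
    (hB : ∀ n, a ^ n ≤ ‖B 0 ^ n‖) {u : FinWord} {c t : ℝ} (hc : 0 < c) (ht : 0 ≤ t)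
    (h : ∀ n, c * t ^ n ≤ ‖wordProd B u ^ n‖) (hu : 0 < u.length) :
    t ≤ jointSpecRad B ^ u.length := by
  have h1 : Tendsto (fun n : ℕ => n * u.length) atTop atTop :=
    tendsto_id.atTop_mul_const' hu
  have h2 := ((tendsto_maxNorm_rpow ha hB).comp h1).pow u.length
  have h3 : Tendsto (fun n : ℕ => c ^ (1 / (n : ℝ)) * t) atTop (𝓝 (1 * t)) :=
    (tendsto_const_rpow_one_div hc).mul_const t
  rw [one_mul] at h3
  refine le_of_tendsto_of_tendsto h3 h2 ?_
  filter_upwards [eventually_gt_atTop 0] with n hn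
  have hle : c * t ^ n ≤ maxNorm B (n * u.length) := by
    refine (h n).trans ?_
    rw [← wordProd_repeatWord, ← length_repeatWord]
    exact norm_wordProd_le_maxNorm _ _
  have hm : 0 ≤ maxNorm B (n * u.length) := le_trans (by positivity) hle
  have hn' : (n : ℝ) ≠ 0 := by positivity
  have hl : (u.length : ℝ) ≠ 0 := by positivity
  calc c ^ (1 / (n : ℝ)) * t = (c * t ^ n) ^ (1 / (n : ℝ)) := by
        rw [Real.mul_rpow hc.le (by positivity), one_div, Real.pow_rpow_inv_natCast ht hn.ne']
    _ ≤ maxNorm B (n * u.length) ^ (1 / (n : ℝ)) := by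
        exact Real.rpow_le_rpow (by positivity) hle (by positivity)
    _ = _ := by
        simp only [Function.comp]
        rw [← Real.rpow_natCast, ← Real.rpow_mul hm]
        congr 1
        push_cast
        field_simp

theorem le_jointSpecRad_of_tendsto {B : Fin 2 → Mat2} {a : ℝ} (ha : 0 < a)
    (hB : ∀ n, a ^ n ≤ ‖B 0 ^ n‖) {x : InfWord} {l : ℝ}
    (h : Tendsto (fun n : ℕ => ‖wordProd B (initialWord x n)‖ ^ (1 / (n : ℝ))) atTop (𝓝 l)) :
    l ≤ jointSpecRad B := by
  refine le_of_tendsto_of_tendsto' h (tendsto_maxNorm_rpow ha hB) fun n => ?_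
  have := norm_wordProd_le_maxNorm B (initialWord x n)
  rw [length_initialWord] at this
  exact Real.rpow_le_rpow (norm_nonneg _) this (by positivity)

theorem weaklyExtremal_of_forall_pow_le {B : Fin 2 → Mat2} {a : ℝ} (ha : 0 < a)
    (hB : ∀ n, a ^ n ≤ ‖B 0 ^ n‖) {x : InfWord}
    (h : ∀ n, jointSpecRad B ^ n ≤ ‖wordProd B (initialWord x n)‖) : WeaklyExtremal B x := by
  have h0 := ha.le.trans (le_jointSpecRad ha hB)
  refine tendsto_of_tendsto_of_tendsto_of_le_of_le' tendsto_const_nhds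
    (tendsto_maxNorm_rpow ha hB) ?_ ?_
  · filter_upwards [eventually_gt_atTop 0] with n hn
    exact rpow_one_div_pow_le h0 hn (h n)
  · refine Eventually.of_forall fun n => ?_
    have := norm_wordProd_le_maxNorm B (initialWord x n)
    rw [length_initialWord] at this
    exact Real.rpow_le_rpow (norm_nonneg _) this (by positivity)

/-- Some shift of `x` has all its short prefixes growing at almost the rate of `x`. -/
theorem exists_shift_forall_pow_le (B : Fin 2 → Mat2) {x : InfWord} {l : ℝ}
    (h : Tendsto (fun n : ℕ => ‖wordProd B (initialWord x n)‖ ^ (1 / (n : ℝ))) atTop (𝓝 l))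
    {g : ℝ} (hg : 0 < g) (hgl : g < l) (N : ℕ) :
    ∃ m, ∀ n ≤ N, g ^ n ≤ ‖wordProd B (initialWord (shiftWord m x) n)‖ := by
  by_contra! hcon
  obtain ⟨M, hM1, hM⟩ : ∃ M : ℝ, 1 ≤ M ∧ ∀ k, ‖B k‖ ≤ M * g := by
    refine ⟨1 + (‖B 0‖ + ‖B 1‖) / g, ?_, fun k => ?_⟩
    · have : 0 ≤ (‖B 0‖ + ‖B 1‖) / g := by positivity
      linarith
    · rw [add_mul, div_mul_cancel₀ _ hg.ne']
      fin_cases k <;> simp <;> linarith [norm_nonneg (B 0), norm_nonneg (B 1)]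
  have hshort : ∀ n (y : InfWord), ‖wordProd B (initialWord y n)‖ ≤ M ^ n * g ^ n := by
    intro n y
    induction n with
    | zero => simp [initialWord_zero, wordProd_nil]
    | succ n ih =>
      rw [initialWord_succ]
      refine (norm_wordProd_append_le _ _ _).trans ?_
      rw [wordProd_singleton]
      calc _ ≤ (M ^ n * g ^ n) * (M * g) := by
            gcongr
            exact hM _
        _ = _ := by ring
  -- Cut greedily into blocks of length at most N whose norm is below g to their length; only the
  -- final incomplete block costs the factor M^N.
  have hlong : ∀ n m, ‖wordProd B (initialWord (shiftWord m x) n)‖ ≤ M ^ N * g ^ n := by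
    intro n
    induction n using Nat.strong_induction_on with
    | _ n ih =>
      intro m
      rcases le_or_gt n N with hn | hn
      · refine (hshort n _).trans ?_
        gcongr
      · obtain ⟨k, hk, hlt⟩ := hcon m
        have hk0 : 0 < k := by
          rcases Nat.eq_zero_or_pos k with rfl | h0
          · simp [initialWord_zero, wordProd_nil] at hlt
          · exact h0
        have e : n = k + (n - k) := by omega
        rw [e, initialWord_add, shiftWord_shiftWord]
        refine (norm_wordProd_append_le _ _ _).trans ?_
        calc _ ≤ g ^ k * (M ^ N * g ^ (n - k)) := by
              gcongr
              exact ih (n - k) (by omega) (m + k)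
          _ = _ := by ring
  have hlim : Tendsto (fun n : ℕ => (M ^ N) ^ (1 / (n : ℝ)) * g) atTop (𝓝 (1 * g)) :=
    (tendsto_const_rpow_one_div (by positivity)).mul_const g
  rw [one_mul] at hlim
  refine absurd (le_of_tendsto_of_tendsto h hlim ?_) (not_le.2 hgl)
  filter_upwards [eventually_gt_atTop 0] with n hn
  have h1 := hlong n 0
  have e : shiftWord 0 x = x := by
    funext i
    simp [shiftWord]
  rw [e] at h1
  refine (Real.rpow_le_rpow (norm_nonneg _) h1 (by positivity : (0:ℝ) ≤ 1 / n)).trans ?_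
  rw [Real.mul_rpow (by positivity) (by positivity), one_div, Real.pow_rpow_inv_natCast hg.le hn.ne']

/-! ### Counting letters in Sturmian words -/

theorem count_one_initialWord_succ (x : InfWord) (n : ℕ) :
    (initialWord x (n + 1)).count 1 = (initialWord x n).count 1 + (x n : ℕ) := by
  rw [initialWord_succ, List.count_append, List.count_singleton]
  congr 1
  generalize x n = k
  fin_cases k <;> simp

theorem count_one_of_telescope {x : InfWord} {f : ℕ → ℤ}
    (h : ∀ n, ((x n : ℕ) : ℤ) = f (n + 1) - f n) (m n : ℕ) :
    ((initialWord (shiftWord m x) n).count 1 : ℤ) = f (m + n) - f m := by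
  induction n with
  | zero => simp [initialWord_zero]
  | succ n ih =>
    rw [count_one_initialWord_succ]
    push_cast
    rw [ih, shiftWord, h, add_assoc]
    ring

/-- Counts telescope to a difference of two roundings. The error is uniform in the shift m, so it
survives limits of shifted words. -/
theorem abs_count_one_sub_le {x : InfWord} {γ : ℝ} (hx : x ∈ SturmianWords γ) (m n : ℕ) :
    |((initialWord (shiftWord m x) n).count 1 : ℝ) - n * γ| ≤ 1 := by
  obtain ⟨δ, h | h⟩ := hx
  · have h1 := count_one_of_telescope (f := fun n : ℕ => ⌊γ * (n : ℝ) + δ⌋)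
      (fun n => by simpa using h n) m n
    have h2 : ((initialWord (shiftWord m x) n).count 1 : ℝ) =
        (⌊γ * ((m + n : ℕ) : ℝ) + δ⌋ : ℝ) - ⌊γ * (m : ℝ) + δ⌋ := by exact_mod_cast h1
    rw [h2, abs_le]
    have e1 := Int.floor_le (γ * ((m + n : ℕ) : ℝ) + δ)
    have e2 := Int.lt_floor_add_one (γ * ((m + n : ℕ) : ℝ) + δ)
    have e3 := Int.floor_le (γ * (m : ℝ) + δ)
    have e4 := Int.lt_floor_add_one (γ * (m : ℝ) + δ)
    push_cast at *
    constructor <;> nlinarith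
  · have h1 := count_one_of_telescope (f := fun n : ℕ => ⌈γ * (n : ℝ) + δ⌉)
      (fun n => by simpa using h n) m n
    have h2 : ((initialWord (shiftWord m x) n).count 1 : ℝ) =
        (⌈γ * ((m + n : ℕ) : ℝ) + δ⌉ : ℝ) - ⌈γ * (m : ℝ) + δ⌉ := by exact_mod_cast h1
    rw [h2, abs_le]
    have e1 := Int.le_ceil (γ * ((m + n : ℕ) : ℝ) + δ)
    have e2 := Int.ceil_lt_add_one (γ * ((m + n : ℕ) : ℝ) + δ)
    have e3 := Int.le_ceil (γ * (m : ℝ) + δ)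
    have e4 := Int.ceil_lt_add_one (γ * (m : ℝ) + δ)
    push_cast at *
    constructor <;> nlinarith

theorem sturmianWords_nonempty {γ : ℝ} (h0 : 0 ≤ γ) (h1 : γ ≤ 1) : (SturmianWords γ).Nonempty := by
  have key : ∀ n : ℕ, ∃ k : Fin 2, ((k : ℕ) : ℤ) = ⌊γ * ((n : ℝ) + 1) + 0⌋ - ⌊γ * (n : ℝ) + 0⌋ := by
    intro n
    have e1 : ⌊γ * (n : ℝ) + 0⌋ ≤ ⌊γ * ((n : ℝ) + 1) + 0⌋ := Int.floor_le_floor (by nlinarith)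
    have e2 : ⌊γ * ((n : ℝ) + 1) + 0⌋ ≤ ⌊γ * (n : ℝ) + 0⌋ + 1 := by
      rw [← Int.floor_add_one]
      exact Int.floor_le_floor (by nlinarith)
    rcases (show ⌊γ * ((n : ℝ) + 1) + 0⌋ - ⌊γ * (n : ℝ) + 0⌋ = 0 ∨
      ⌊γ * ((n : ℝ) + 1) + 0⌋ - ⌊γ * (n : ℝ) + 0⌋ = 1 by omega) with h | h
    · exact ⟨0, by rw [h]; rfl⟩
    · exact ⟨1, by rw [h]; rfl⟩
  choose x hx using key
  exact ⟨x, 0, Or.inl hx⟩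

/-! ### The joint spectral radius as a function of the parameter -/

section Ratio

variable {A : Fin 2 → Mat2} {r : ℝ≥0 → Set.Icc (0 : ℝ) 1}

theorem TechnicalHypotheses.exists_pow_le_norm_pow (hA : TechnicalHypotheses A) (k : Fin 2) :
    ∃ a : ℝ, 0 < a ∧ ∀ n, a ^ n ≤ ‖A k ^ n‖ := by
  obtain ⟨i, hi⟩ := exists_diag_pos (hA.trace_pos k)
  exact ⟨A k i i, hi, pow_diag_le_norm_pow (hA.nonneg k) i⟩

theorem TechnicalHypotheses.jointSpecRad_pos (hA : TechnicalHypotheses A) (α : ℝ) :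
    0 < jointSpecRad (scaledPair A α) := by
  obtain ⟨a, ha, h⟩ := hA.exists_pow_le_norm_pow 0
  exact ha.trans_le (le_jointSpecRad (B := scaledPair A α) ha h)

theorem IsOneRatioFunction.sturmianWords_nonempty (_ : IsOneRatioFunction A r) (α : ℝ≥0) :
    (SturmianWords (r α)).Nonempty :=
  _root_.sturmianWords_nonempty (r α).2.1 (r α).2.2

/-- At α = 0 a single letter 1 annihilates every later product, whereas ϱ(0) > 0. -/
theorem IsOneRatioFunction.eq_zero_of_mem (hA : TechnicalHypotheses A)
    (hr : IsOneRatioFunction A r) {x : InfWord} (hx : x ∈ SturmianWords (r 0)) (n : ℕ) :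
    x n = 0 := by
  by_contra hn
  have hn1 : (x n : ℕ) = 1 := by omega
  have hcount : ∀ m, n < m → 0 < (initialWord x m).count 1 := by
    intro m hm
    induction m with
    | zero => omega
    | succ m ih =>
      rw [count_one_initialWord_succ]
      rcases (Nat.lt_succ_iff.1 hm).eq_or_lt with rfl | h
      · omega
      · have := ih h
        omega
  have h0 : Tendsto (fun m : ℕ => ‖wordProd (scaledPair A ((0 : ℝ≥0) : ℝ)) (initialWord x m)‖ ^
      (1 / (m : ℝ))) atTop (𝓝 0) := by
    refine tendsto_const_nhds.congr' ?_
    filter_upwards [eventually_gt_atTop n] with m hm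
    have hm' : (1 / (m : ℝ)) ≠ 0 := by
      have : 0 < m := by omega
      positivity
    rw [norm_wordProd_scaledPair A (by simp), NNReal.coe_zero, zero_pow (hcount m hm).ne', zero_mul,
      Real.zero_rpow hm']
  have := tendsto_nhds_unique h0 (hr.extremal 0 x hx)
  exact (hA.jointSpecRad_pos _).ne this

theorem count_one_eq_zero {x : InfWord} (h : ∀ n, x n = 0) (n : ℕ) :
    (initialWord x n).count 1 = 0 := by
  induction n with
  | zero => simp [initialWord_zero]
  | succ n ih => rw [count_one_initialWord_succ, ih, h]; rfl

theorem IsOneRatioFunction.map_zero (hA : TechnicalHypotheses A) (hr : IsOneRatioFunction A r) :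
    (r 0 : ℝ) = 0 := by
  obtain ⟨x, hx⟩ := hr.sturmianWords_nonempty 0
  have hf := hr.frequency 0 x (hr.extremal 0 x hx)
  refine tendsto_nhds_unique hf (tendsto_const_nhds.congr fun n => ?_)
  rw [count_one_eq_zero (hr.eq_zero_of_mem hA hx)]
  simp

theorem IsOneRatioFunction.jointSpecRad_zero_le (hA : TechnicalHypotheses A)
    (hr : IsOneRatioFunction A r) (α : ℝ≥0) :
    jointSpecRad (scaledPair A (0 : ℝ≥0)) ≤ jointSpecRad (scaledPair A α) := by
  obtain ⟨x, hx⟩ := hr.sturmianWords_nonempty 0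
  obtain ⟨a, ha, h⟩ := hA.exists_pow_le_norm_pow 0
  refine le_jointSpecRad_of_tendsto (B := scaledPair A α) ha h (x := x)
    ((hr.extremal 0 x hx).congr fun n => ?_)
  rw [norm_wordProd_scaledPair A (by simp), norm_wordProd_scaledPair A (NNReal.coe_nonneg α),
    count_one_eq_zero (hr.eq_zero_of_mem hA hx)]
  simp

/-- Passing from α to β multiplies the norm along a word by (β/α) to the number of 1s; along an
extremal word for α this number has density r(α). -/
theorem IsOneRatioFunction.rpow_mul_jointSpecRad_le (hA : TechnicalHypotheses A)
    (hr : IsOneRatioFunction A r) {α β : ℝ≥0} (hα : 0 < α) (hβ : 0 < β) :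
    ((β : ℝ) / α) ^ (r α : ℝ) * jointSpecRad (scaledPair A α) ≤ jointSpecRad (scaledPair A β) := by
  obtain ⟨x, hx⟩ := hr.sturmianWords_nonempty α
  obtain ⟨a, ha, h⟩ := hA.exists_pow_le_norm_pow 0
  have hα' : (0 : ℝ) < α := hα
  have hβ' : (0 : ℝ) < β := hβ
  have hext := hr.extremal α x hx
  have hpow := (Real.continuousAt_const_rpow (b := (r α : ℝ)) (div_pos hβ' hα').ne').tendsto.comp
    (hr.frequency α x hext)
  refine le_jointSpecRad_of_tendsto (B := scaledPair A β) ha h (x := x)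
    ((hpow.mul hext).congr fun n => ?_)
  simp only [Function.comp]
  rw [norm_wordProd_scaledPair A (NNReal.coe_nonneg α),
    norm_wordProd_scaledPair A (NNReal.coe_nonneg β), div_eq_mul_one_div (List.count _ _ : ℝ),
    Real.rpow_mul (div_pos hβ' hα').le, Real.rpow_natCast,
    ← Real.mul_rpow (by positivity) (by positivity), ← mul_assoc, ← mul_pow,
    div_mul_cancel₀ _ hα'.ne']

/-- The subgradient inequality applied from α to β and from β to α. -/
theorem IsOneRatioFunction.monotone (hA : TechnicalHypotheses A) (hr : IsOneRatioFunction A r) :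
    Monotone r := by
  intro α β hαβ
  rw [← Subtype.coe_le_coe]
  rcases eq_zero_or_pos α with rfl | hα
  · rw [hr.map_zero hA]
    exact (r β).2.1
  rcases hαβ.eq_or_lt with rfl | hlt
  · exact le_rfl
  have hβ := hα.trans hlt
  have hα' : (0 : ℝ) < α := hα
  have hβ' : (0 : ℝ) < β := hβ
  have hlt' : (α : ℝ) < β := hlt
  have h1 := hr.rpow_mul_jointSpecRad_le hA hα hβ
  have h2 := hr.rpow_mul_jointSpecRad_le hA hβ hα
  have hr1 := hA.jointSpecRad_pos α
  have h3 : ((β : ℝ) / α) ^ (r α : ℝ) ≤ ((β : ℝ) / α) ^ (r β : ℝ) := by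
    rw [← inv_div (β : ℝ) α, Real.inv_rpow (by positivity), inv_mul_le_iff₀ (by positivity)] at h2
    exact le_of_mul_le_mul_right (h1.trans h2) hr1
  exact (Real.rpow_le_rpow_left_iff ((one_lt_div hα').2 hlt')).1 h3

/-- The word 1ⁿ gives ϱ(α) ≥ αc, and the subgradient inequality at 1 gives ϱ(1) ≥ α^(−r(α)) ϱ(α), so
α^(1−γ) c ≤ ϱ(1) once α > 1. -/
theorem IsOneRatioFunction.exists_le_of_le (hA : TechnicalHypotheses A)
    (hr : IsOneRatioFunction A r) {γ : ℝ} (hγ : γ < 1) :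
    ∃ b : ℝ≥0, ∀ α, (r α : ℝ) ≤ γ → α ≤ b := by
  obtain ⟨a, ha, h⟩ := hA.exists_pow_le_norm_pow 0
  obtain ⟨c, hc, hc'⟩ := hA.exists_pow_le_norm_pow 1
  set R := jointSpecRad (scaledPair A (1 : ℝ≥0)) with hR
  have hR0 : 0 < R := hA.jointSpecRad_pos _
  refine ⟨max 1 (Real.toNNReal ((R / c) ^ (1 / (1 - γ)))), fun α hα => ?_⟩
  by_contra! hcon
  have h1 : 1 < α := (le_max_left _ _).trans_lt hcon
  have h2 : (R / c) ^ (1 / (1 - γ)) < α :=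
    (Real.toNNReal_lt_iff_lt_coe (by positivity)).1 ((le_max_right _ _).trans_lt hcon)
  have h1' : (1 : ℝ) < α := h1
  have h0' : (0 : ℝ) < α := by linarith
  have h3 := hr.rpow_mul_jointSpecRad_le hA (zero_lt_one.trans h1) zero_lt_one
  have h4 : α * c ≤ jointSpecRad (scaledPair A α) := by
    have := le_jointSpecRad_pow (B := scaledPair A α) ha h (u := [1]) (c := 1) (t := α * c)
      one_pos (by positivity) (fun n => ?_) (by simp)
    · simpa using this
    · rw [one_mul, wordProd_singleton, mul_pow]
      simp only [scaledPair, Matrix.cons_val_one, Matrix.cons_val_fin_one]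
      rw [smul_pow, norm_smul, Real.norm_of_nonneg (by positivity)]
      gcongr
      exact hc' n
  have h5 : (α : ℝ) ^ (1 - γ) * c ≤ R := by
    refine le_trans ?_ h3
    have e : (α : ℝ) ^ (1 - γ) ≤ ((1 : ℝ≥0) / (α : ℝ)) ^ (r α : ℝ) * α := by
      rw [NNReal.coe_one, one_div, Real.inv_rpow h0'.le, ← Real.rpow_neg h0'.le]
      nth_rw 3 [← Real.rpow_one (α : ℝ)]
      rw [← Real.rpow_add h0']
      exact Real.rpow_le_rpow_of_exponent_le h1'.le (by linarith)
    calc _ ≤ (((1 : ℝ≥0) / (α : ℝ)) ^ (r α : ℝ) * α) * c := by gcongr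
      _ = ((1 : ℝ≥0) / (α : ℝ)) ^ (r α : ℝ) * (α * c) := by ring
      _ ≤ _ := by gcongr
  have h6 := Real.rpow_lt_rpow (by positivity) h2 (z := 1 - γ) (by linarith)
  rw [← Real.rpow_mul (by positivity), one_div_mul_cancel (by linarith), Real.rpow_one] at h6
  rw [← le_div_iff₀ hc] at h5
  linarith

/-- Lower semicontinuity of ϱ, from the subgradient inequality. At α = 0 the extremal word 0^∞
replaces it. -/
theorem IsOneRatioFunction.eventually_lt_jointSpecRad (hA : TechnicalHypotheses A)
    (hr : IsOneRatioFunction A r) (α : ℝ≥0) {g : ℝ} (hg : g < jointSpecRad (scaledPair A α)) :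
    ∀ᶠ β : ℝ≥0 in 𝓝 α, g < jointSpecRad (scaledPair A β) := by
  rcases eq_zero_or_pos α with rfl | hα
  · exact Eventually.of_forall fun β => hg.trans_le (hr.jointSpecRad_zero_le hA β)
  have hα' : (α : ℝ) ≠ 0 := by exact_mod_cast hα.ne'
  have hlim : Tendsto (fun β : ℝ≥0 => ((β : ℝ) / α) ^ (r α : ℝ) * jointSpecRad (scaledPair A α))
      (𝓝 α) (𝓝 (((α : ℝ) / α) ^ (r α : ℝ) * jointSpecRad (scaledPair A α))) := by
    refine Tendsto.mul_const _ (Tendsto.rpow_const ?_ (Or.inr (r α).2.1))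
    exact (NNReal.continuous_coe.tendsto α).div_const _
  rw [div_self hα', Real.one_rpow, one_mul] at hlim
  filter_upwards [hlim.eventually (lt_mem_nhds hg), lt_mem_nhds hα] with β h1 h2
  exact h1.trans_le (hr.rpow_mul_jointSpecRad_le hA hα h2)

/-! ### Limits of extremal words and level sets of the ratio function -/

theorem continuous_norm_wordProd_scaledPair (A : Fin 2 → Mat2) (u : FinWord) :
    Continuous fun α : ℝ≥0 => ‖wordProd (scaledPair A α) u‖ := by
  have : (fun α : ℝ≥0 => ‖wordProd (scaledPair A α) u‖) =
      fun α : ℝ≥0 => (α : ℝ) ^ u.count 1 * ‖wordProd A u‖ := by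
    funext α
    exact norm_wordProd_scaledPair A (NNReal.coe_nonneg α) u
  rw [this]
  fun_prop

theorem finite_setOf_length_le (N : ℕ) : {u : FinWord | u.length ≤ N}.Finite :=
  List.finite_length_le (Fin 2) N

theorem isClosed_setOf_initialWord (Q : FinWord → Prop) (n : ℕ) :
    IsClosed {y : InfWord | Q (initialWord y n)} := by
  have hc : Continuous fun (y : InfWord) (i : Fin n) => y i := by fun_prop
  exact (isClosed_discrete {w : Fin n → Fin 2 | Q (List.ofFn w)}).preimage hc

/-- A property of prefixes shared by the extremal words with parameters in `S` passes to a
weakly extremal word at each parameter in the closure of `S`. -/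
theorem IsOneRatioFunction.exists_weaklyExtremal_of_mem_closure (hA : TechnicalHypotheses A)
    (hr : IsOneRatioFunction A r) {S : Set ℝ≥0} {Q : FinWord → Prop}
    (hS : ∀ α ∈ S, ∀ x ∈ SturmianWords (r α), ∀ m n, Q (initialWord (shiftWord m x) n))
    {α : ℝ≥0} (hα : α ∈ closure S) :
    ∃ y : InfWord, WeaklyExtremal (scaledPair A α) y ∧ ∀ n, Q (initialWord y n) := by
  set R := jointSpecRad (scaledPair A α) with hR
  have hR0 : 0 < R := hA.jointSpecRad_pos α
  obtain ⟨g, hmono, hgR, hglim⟩ := exists_seq_strictMono_tendsto' hR0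
  let E : ℕ → Set InfWord := fun k =>
    {y | ∀ n ≤ k, g k ^ n ≤ ‖wordProd (scaledPair A α) (initialWord y n)‖ ∧ Q (initialWord y n)}
  have hEc : ∀ k, IsClosed (E k) := by
    intro k
    have : E k = ⋂ n ≤ k, {y | g k ^ n ≤ ‖wordProd (scaledPair A α) (initialWord y n)‖ ∧
        Q (initialWord y n)} := by
      ext y
      simp [E]
    rw [this]
    exact isClosed_biInter fun n _ => isClosed_setOf_initialWord
      (fun u => g k ^ n ≤ ‖wordProd (scaledPair A α) u‖ ∧ Q u) n
  have hanti : ∀ k, E (k + 1) ⊆ E k := by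
    intro k y hy n hn
    refine ⟨le_trans ?_ (hy n (hn.trans k.le_succ)).1, (hy n (hn.trans k.le_succ)).2⟩
    exact pow_le_pow_left₀ (hgR k).1.le (hmono k.lt_succ_self).le n
  have hne : ∀ k, (E k).Nonempty := by
    intro k
    -- Used in contrapositive form: for β near α, a short word whose product at β reaches g_k^|u|
    -- also reaches it at α.
    have hev : ∀ᶠ β : ℝ≥0 in 𝓝 α, ∀ u ∈ {u : FinWord | u.length ≤ k},
        ‖wordProd (scaledPair A α) u‖ < g k ^ u.length →
          ‖wordProd (scaledPair A β) u‖ < g k ^ u.length := by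
      rw [(finite_setOf_length_le k).eventually_all]
      intro u _
      by_cases hu : ‖wordProd (scaledPair A α) u‖ < g k ^ u.length
      · filter_upwards [(continuous_norm_wordProd_scaledPair A u).continuousAt.eventually_lt
          continuousAt_const hu] with β hβ _ using hβ
      · exact Eventually.of_forall fun β h => absurd h hu
    obtain ⟨β, hβS, h1, h2⟩ := ((mem_closure_iff_frequently.1 hα).and_eventually
      (hev.and (hr.eventually_lt_jointSpecRad hA α (hgR k).2))).exists
    obtain ⟨x, hx⟩ := hr.sturmianWords_nonempty β
    obtain ⟨m, hm⟩ := exists_shift_forall_pow_le _ (hr.extremal β x hx) (hgR k).1 h2 k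
    refine ⟨shiftWord m x, fun n hn => ⟨?_, hS β hβS x hx m n⟩⟩
    by_contra! hlt
    have := h1 (initialWord (shiftWord m x) n) (by simpa [length_initialWord] using hn)
      (by rwa [length_initialWord])
    rw [length_initialWord] at this
    exact absurd (hm n hn) (not_le.2 this)
  obtain ⟨y, hy⟩ := IsCompact.nonempty_iInter_of_sequence_nonempty_isCompact_isClosed E hanti hne
    (hEc 0).isCompact hEc
  rw [Set.mem_iInter] at hy
  obtain ⟨a, ha, h⟩ := hA.exists_pow_le_norm_pow 0
  refine ⟨y, weaklyExtremal_of_forall_pow_le (B := scaledPair A α) ha h fun n => ?_,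
    fun n => (hy n n le_rfl).2⟩
  refine le_of_tendsto (hglim.pow n) ?_
  filter_upwards [eventually_ge_atTop n] with k hk
  exact (hy k n hk).1

/-- The bound "at most nγ + 1 ones among n letters" is a prefix property, so the weakly extremal
limit word has it and its frequency is at most γ. -/
theorem IsOneRatioFunction.isClosed_setOf_le (hA : TechnicalHypotheses A)
    (hr : IsOneRatioFunction A r) (γ : ℝ) : IsClosed {α | (r α : ℝ) ≤ γ} := by
  refine isClosed_of_closure_subset fun α hα => ?_
  have hS : ∀ β ∈ {α : ℝ≥0 | (r α : ℝ) ≤ γ}, ∀ x ∈ SturmianWords (r β), ∀ m n,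
      (fun u : FinWord => (u.count 1 : ℝ) ≤ u.length * γ + 1) (initialWord (shiftWord m x) n) := by
    intro β hβ x hx m n
    have h1 := (abs_le.1 (abs_count_one_sub_le hx m n)).2
    simp only [length_initialWord]
    have h2 : (r β : ℝ) ≤ γ := hβ
    have h3 : (n : ℝ) * r β ≤ n * γ := by gcongr
    linarith
  obtain ⟨y, hy, hQ⟩ := hr.exists_weaklyExtremal_of_mem_closure hA
    (Q := fun u => (u.count 1 : ℝ) ≤ u.length * γ + 1) hS hα
  have h1 : Tendsto (fun n : ℕ => γ + 1 / (n : ℝ)) atTop (𝓝 (γ + 0)) :=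
    tendsto_const_nhds.add tendsto_one_div_atTop_nhds_zero_nat
  rw [add_zero] at h1
  refine le_of_tendsto_of_tendsto (hr.frequency α y hy) h1 ?_
  filter_upwards [eventually_gt_atTop 0] with n hn
  have hn' : (0 : ℝ) < n := by exact_mod_cast hn
  have := hQ n
  simp only [length_initialWord] at this
  rw [div_le_iff₀ hn', add_mul, one_div_mul_cancel hn'.ne']
  linarith

theorem IsOneRatioFunction.isClosed_setOf_ge (hA : TechnicalHypotheses A)
    (hr : IsOneRatioFunction A r) (γ : ℝ) : IsClosed {α | γ ≤ (r α : ℝ)} := by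
  refine isClosed_of_closure_subset fun α hα => ?_
  have hS : ∀ β ∈ {α : ℝ≥0 | γ ≤ (r α : ℝ)}, ∀ x ∈ SturmianWords (r β), ∀ m n,
      (fun u : FinWord => u.length * γ - 1 ≤ (u.count 1 : ℝ)) (initialWord (shiftWord m x) n) := by
    intro β hβ x hx m n
    have h1 := (abs_le.1 (abs_count_one_sub_le hx m n)).1
    simp only [length_initialWord]
    have h2 : γ ≤ (r β : ℝ) := hβ
    have h3 : (n : ℝ) * γ ≤ n * r β := by gcongr
    linarith
  obtain ⟨y, hy, hQ⟩ := hr.exists_weaklyExtremal_of_mem_closure hA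
    (Q := fun u => u.length * γ - 1 ≤ (u.count 1 : ℝ)) hS hα
  have h1 : Tendsto (fun n : ℕ => γ - 1 / (n : ℝ)) atTop (𝓝 (γ - 0)) :=
    tendsto_const_nhds.sub tendsto_one_div_atTop_nhds_zero_nat
  rw [sub_zero] at h1
  refine le_of_tendsto_of_tendsto h1 (hr.frequency α y hy) ?_
  filter_upwards [eventually_gt_atTop 0] with n hn
  have hn' : (0 : ℝ) < n := by exact_mod_cast hn
  have := hQ n
  simp only [length_initialWord] at this
  rw [le_div_iff₀ hn', sub_mul, one_div_mul_cancel hn'.ne']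
  linarith

theorem IsOneRatioFunction.exists_eq_Icc (hA : TechnicalHypotheses A)
    (hr : IsOneRatioFunction A r) {γ : ℝ} (h0 : 0 < γ) (h1 : γ < 1) :
    ∃ a b : ℝ≥0, 0 < a ∧ a ≤ b ∧ {α : ℝ≥0 | (r α : ℝ) = γ} = Set.Icc a b := by
  obtain ⟨c, hc⟩ := hr.exists_le_of_le hA h1
  have hle := hr.isClosed_setOf_le hA γ
  have hge := hr.isClosed_setOf_ge hA γ
  have heq : {α : ℝ≥0 | (r α : ℝ) = γ} = {α | (r α : ℝ) ≤ γ} ∩ {α | γ ≤ (r α : ℝ)} := by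
    ext α
    exact le_antisymm_iff
  have hne : {α : ℝ≥0 | (r α : ℝ) = γ}.Nonempty := by
    rw [heq]
    -- The two closed sets cover [0, ∞) and contain 0 and c + 1 respectively, so they meet.
    have := isPreconnected_closed_iff.1 (isPreconnected_univ (α := ℝ≥0)) _ _ hle hge
      (fun α _ => le_total (r α : ℝ) γ) ⟨0, trivial, ?_⟩ ⟨c + 1, trivial, ?_⟩
    · simpa using this
    · rw [Set.mem_ofPred_eq, hr.map_zero hA]
      exact h0.le
    · by_contra hcon
      exact absurd (hc (c + 1) (not_le.1 hcon).le) (by simp)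
  have hcl : IsClosed {α : ℝ≥0 | (r α : ℝ) = γ} := heq ▸ hle.inter hge
  have hcomp : IsCompact {α : ℝ≥0 | (r α : ℝ) = γ} :=
    isCompact_Icc.of_isClosed_subset (s := Set.Icc 0 c) hcl
      fun α hα => ⟨zero_le, hc α (le_of_eq hα)⟩
  have hord : Set.OrdConnected {α : ℝ≥0 | (r α : ℝ) = γ} := by
    refine ⟨fun α hα β hβ δ hδ => le_antisymm ?_ ?_⟩
    · exact (Subtype.coe_le_coe.2 (hr.monotone hA hδ.2)).trans (le_of_eq hβ)
    · exact (le_of_eq (Eq.symm hα)).trans (Subtype.coe_le_coe.2 (hr.monotone hA hδ.1))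
  have hIcc := eq_Icc_of_connected_compact ⟨hne, hord.isPreconnected⟩ hcomp
  refine ⟨_, _, ?_, ?_, hIcc⟩
  · have hmem := hcomp.sInf_mem hne
    rw [pos_iff_ne_zero]
    intro h
    rw [h, Set.mem_ofPred_eq, hr.map_zero hA] at hmem
    exact h0.ne hmem
  · exact (hcomp.isLeast_sInf hne).2 (hcomp.sSup_mem hne)

end Ratio

/-! ### Positive `2 × 2` matrices -/

/-- The Perron eigenvectors of a positive `2 × 2` matrix, and the convergence of its normalized
powers to the corresponding rank one projection. -/
theorem exists_perron {K : Mat2} (hK : ∀ i j, 0 < K i j) :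
    ∃ (l : ℝ) (v w : Fin 2 → ℝ), 0 < l ∧ (∀ i, 0 < v i) ∧ (∀ i, 0 < w i) ∧
      K.mulVec v = l • v ∧ K.vecMul w = l • w ∧
      ∀ z, Tendsto (fun N : ℕ => (l⁻¹) ^ N • (K ^ N).mulVec z) atTop
        (𝓝 (((w ⬝ᵥ z) / (w ⬝ᵥ v)) • v)) := by
  have h00 := hK 0 0
  have h01 := hK 0 1
  have h10 := hK 1 0
  have h11 := hK 1 1
  set s := √((K 0 0 - K 1 1) ^ 2 + 4 * (K 0 1 * K 1 0)) with hs
  have hs2 : s ^ 2 = (K 0 0 - K 1 1) ^ 2 + 4 * (K 0 1 * K 1 0) := Real.sq_sqrt (by positivity)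
  have hbc := mul_pos h01 h10
  have hs0 : 0 ≤ s := Real.sqrt_nonneg _
  have hsabs : |K 0 0 - K 1 1| < s := abs_lt_of_sq_lt_sq (by linarith) hs0
  obtain ⟨hs3, hs4⟩ := abs_lt.1 hsabs
  set l := (K 0 0 + K 1 1 + s) / 2 with hl
  -- The other eigenvalue; its eigenspace is the kernel of w, which contains y = z − cv.
  set μ := K 0 0 + K 1 1 - l with hμ
  have hchar : (l - K 0 0) * (l - K 1 1) = K 0 1 * K 1 0 := by
    rw [hl]
    linear_combination hs2 / 4
  have hl0 : 0 < l - K 0 0 := by rw [hl]; linarith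
  have hlpos : 0 < l := by linarith
  have hμl : |μ| < l := by
    rw [abs_lt, hμ, hl]
    constructor <;> linarith
  have hv : K.mulVec ![K 0 1, l - K 0 0] = l • ![K 0 1, l - K 0 0] := by
    funext i
    fin_cases i
    · simp [Matrix.mulVec, dotProduct, Fin.sum_univ_two]
      ring
    · simp [Matrix.mulVec, dotProduct, Fin.sum_univ_two]
      linear_combination -hchar
  have hw : K.vecMul ![K 1 0, l - K 0 0] = l • ![K 1 0, l - K 0 0] := by
    funext i
    fin_cases i
    · simp [Matrix.vecMul, dotProduct, Fin.sum_univ_two]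
      ring
    · simp [Matrix.vecMul, dotProduct, Fin.sum_univ_two]
      linear_combination -hchar
  have hvpos : ∀ i, 0 < (![K 0 1, l - K 0 0] : Fin 2 → ℝ) i := by
    intro i
    fin_cases i
    · simpa
    · exact hl0
  have hwpos : ∀ i, 0 < (![K 1 0, l - K 0 0] : Fin 2 → ℝ) i := by
    intro i
    fin_cases i
    · simpa
    · exact hl0
  refine ⟨l, ![K 0 1, l - K 0 0], ![K 1 0, l - K 0 0], hlpos, hvpos, hwpos, hv, hw, fun z => ?_⟩
  set v : Fin 2 → ℝ := ![K 0 1, l - K 0 0] with hvdef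
  set w : Fin 2 → ℝ := ![K 1 0, l - K 0 0] with hwdef
  have hwv : 0 < w ⬝ᵥ v := by
    rw [dotProduct, Fin.sum_univ_two]
    exact add_pos (mul_pos (hwpos 0) (hvpos 0)) (mul_pos (hwpos 1) (hvpos 1))
  set c := (w ⬝ᵥ z) / (w ⬝ᵥ v) with hc
  set y := z - c • v with hy
  have hwy : w ⬝ᵥ y = 0 := by
    rw [hy, dotProduct_sub, dotProduct_smul, hc, smul_eq_mul, div_mul_cancel₀ _ hwv.ne', sub_self]
  have hKy : K.mulVec y = μ • y := by
    have h : K 1 0 * y 0 + (l - K 0 0) * y 1 = 0 := by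
      simpa [hwdef, dotProduct, Fin.sum_univ_two] using hwy
    funext i
    fin_cases i
    · simp only [Matrix.mulVec, dotProduct, Fin.sum_univ_two, Fin.zero_eta, Pi.smul_apply,
        smul_eq_mul, hμ]
      have : (l - K 0 0) * (K 0 0 * y 0 + K 0 1 * y 1 - (K 0 0 + K 1 1 - l) * y 0) = 0 := by
        linear_combination K 0 1 * h + y 0 * hchar
      have := (mul_eq_zero.1 this).resolve_left hl0.ne'
      linarith
    · simp only [Matrix.mulVec, dotProduct, Fin.sum_univ_two, Fin.mk_one, Pi.smul_apply,
        smul_eq_mul, hμ]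
      linear_combination h
  have hpow : ∀ (t : ℝ) (u : Fin 2 → ℝ), K.mulVec u = t • u → ∀ N : ℕ,
      (K ^ N).mulVec u = t ^ N • u := by
    intro t u hu N
    induction N with
    | zero => simp
    | succ N ih =>
      rw [pow_succ, ← Matrix.mulVec_mulVec, hu, Matrix.mulVec_smul, ih, smul_smul, pow_succ']
  have heq : ∀ N : ℕ, (l⁻¹) ^ N • (K ^ N).mulVec z = c • v + (μ / l) ^ N • y := by
    intro N
    have : z = c • v + y := by rw [hy]; abel
    have hlN : l ^ N ≠ 0 := (pow_pos hlpos N).ne'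
    rw [this, Matrix.mulVec_add, Matrix.mulVec_smul, hpow l v hv, hpow μ y hKy, smul_add, smul_smul,
      smul_smul, smul_smul, div_pow μ l, inv_pow, mul_assoc, mul_comm c, ← mul_assoc,
      inv_mul_cancel₀ hlN, one_mul, inv_mul_eq_div]
  simp_rw [heq]
  have hlim : Tendsto (fun N : ℕ => (μ / l) ^ N) atTop (𝓝 0) := by
    refine tendsto_pow_atTop_nhds_zero_of_abs_lt_one ?_
    rwa [abs_div, abs_of_pos hlpos, div_lt_one hlpos]
  simpa using tendsto_const_nhds.add (hlim.smul_const y)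

theorem mulVec_mono {M : Mat2} (hM : ∀ i j, 0 ≤ M i j) {x y : Fin 2 → ℝ} (h : x ≤ y) :
    M.mulVec x ≤ M.mulVec y := by
  intro i
  simp only [Matrix.mulVec, dotProduct]
  exact Finset.sum_le_sum fun j _ => mul_le_mul_of_nonneg_left (h j) (hM i j)

theorem mulVec_nonneg {M : Mat2} (hM : ∀ i j, 0 ≤ M i j) {x : Fin 2 → ℝ} (hx : ∀ i, 0 ≤ x i)
    (i : Fin 2) : 0 ≤ M.mulVec x i :=
  dotProduct_nonneg_of_nonneg (fun j => hM i j) hx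

theorem vecMul_nonneg {M : Mat2} (hM : ∀ i j, 0 ≤ M i j) {x : Fin 2 → ℝ} (hx : ∀ i, 0 ≤ x i)
    (i : Fin 2) : 0 ≤ M.vecMul x i :=
  dotProduct_nonneg_of_nonneg hx fun j => hM j i

/-- A positive subeigenvector can be iterated, since M preserves the componentwise order. -/
theorem exists_mul_pow_le_norm_pow {M : Mat2} (hM : ∀ i j, 0 ≤ M i j) {v : Fin 2 → ℝ}
    (hv : ∀ i, 0 < v i) {t : ℝ} (ht : 0 ≤ t) (h : t • v ≤ M.mulVec v) :
    ∃ c, 0 < c ∧ ∀ n : ℕ, c * t ^ n ≤ ‖M ^ n‖ := by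
  have hn : ∀ n : ℕ, t ^ n • v ≤ (M ^ n).mulVec v := by
    intro n
    induction n with
    | zero => simp
    | succ n ih =>
      rw [pow_succ' M, ← Matrix.mulVec_mulVec]
      refine le_trans ?_ (mulVec_mono hM ih)
      rw [Matrix.mulVec_smul, pow_succ, mul_smul]
      exact smul_le_smul_of_nonneg_left h (pow_nonneg ht n)
  have h0 := hv 0
  have h1 := hv 1
  refine ⟨v 0 / (v 0 + v 1), by positivity, fun n => ?_⟩
  have := hn n 0
  simp only [Pi.smul_apply, smul_eq_mul, Matrix.mulVec, dotProduct, Fin.sum_univ_two] at this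
  have e0 := (le_abs_self _).trans (Matrix.abs_entry_le_l2_opNorm (M ^ n) 0 0)
  have e1 := (le_abs_self _).trans (Matrix.abs_entry_le_l2_opNorm (M ^ n) 0 1)
  rw [div_mul_eq_mul_div, div_le_iff₀ (by positivity)]
  nlinarith

/-- The normalized power limit bounds the contribution of inserting a word `T` into a long
repetition of `U`. -/
theorem dotProduct_mulVec_le {B : Fin 2 → Mat2} (hB0 : ∀ k i j, 0 ≤ B k i j) {a : ℝ} (ha : 0 < a)
    (hB : ∀ n, a ^ n ≤ ‖B 0 ^ n‖) {U : FinWord} (hU : 0 < U.length) {l : ℝ} {v w : Fin 2 → ℝ}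
    (hl : 0 < l) (hv : ∀ i, 0 < v i) (hw : ∀ i, 0 < w i)
    (hlim : ∀ z, Tendsto (fun N : ℕ => (l⁻¹) ^ N • (wordProd B U ^ N).mulVec z) atTop
        (𝓝 (((w ⬝ᵥ z) / (w ⬝ᵥ v)) • v)))
    (hle : jointSpecRad B ^ U.length ≤ l) (T : FinWord) :
    w ⬝ᵥ (wordProd B T).mulVec v ≤ jointSpecRad B ^ T.length * (w ⬝ᵥ v) := by
  have hR : 0 ≤ jointSpecRad B := ha.le.trans (le_jointSpecRad ha hB)
  have hwv : 0 < w ⬝ᵥ v := by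
    rw [dotProduct, Fin.sum_univ_two]
    exact add_pos (mul_pos (hw 0) (hv 0)) (mul_pos (hw 1) (hv 1))
  by_contra! hcon
  rw [← lt_div_iff₀ hwv] at hcon
  obtain ⟨s, hs1, hs2⟩ := exists_between hcon
  have hs0 : 0 < s := (pow_nonneg hR _).trans_lt hs1
  have hev : ∀ᶠ N : ℕ in atTop, ∀ i,
      s * v i < ((l⁻¹) ^ N • (wordProd B U ^ N).mulVec ((wordProd B T).mulVec v)) i := by
    rw [eventually_all]
    intro i
    refine ((tendsto_pi_nhds.1 (hlim ((wordProd B T).mulVec v))) i).eventually_const_lt ?_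
    simp only [Pi.smul_apply, smul_eq_mul]
    exact mul_lt_mul_of_pos_right hs2 (hv i)
  -- N ≥ 1 keeps the word T Uᴺ nonempty even when T is empty.
  obtain ⟨N, hN, hN1⟩ := (hev.and (eventually_ge_atTop 1)).exists
  set P := wordProd B (T ++ repeatWord U N) with hP
  have hPv : (s * l ^ N) • v ≤ P.mulVec v := by
    intro i
    have := (hN i).le
    rw [hP, wordProd_append, wordProd_repeatWord, ← Matrix.mulVec_mulVec]
    simp only [Pi.smul_apply, smul_eq_mul, inv_pow] at this ⊢
    rw [inv_mul_eq_div, le_div_iff₀ (by positivity)] at this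
    linarith
  obtain ⟨c, hc, hcn⟩ := exists_mul_pow_le_norm_pow (wordProd_nonneg hB0 _) hv (by positivity) hPv
  have hfin := le_jointSpecRad_pow ha hB hc (by positivity) hcn (by
    rw [List.length_append, length_repeatWord]
    have := Nat.mul_pos hN1 hU
    omega)
  rw [List.length_append, length_repeatWord, pow_add, mul_comm N, pow_mul] at hfin
  have h1 : (jointSpecRad B ^ U.length) ^ N ≤ l ^ N := pow_le_pow_left₀ (pow_nonneg hR _) hle N
  have h2 : s * l ^ N ≤ jointSpecRad B ^ T.length * l ^ N :=
    hfin.trans (mul_le_mul_of_nonneg_left h1 (pow_nonneg hR _))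
  exact absurd (le_of_mul_le_mul_right h2 (by positivity)) (not_le.2 hs1)

/-- As Kⁿv = lⁿv with nonnegative terms, each entry of Kⁿ is at most lⁿ vᵢ/vⱼ. -/
theorem exists_norm_pow_le {K : Mat2} (hK : ∀ i j, 0 ≤ K i j) {l : ℝ} {v : Fin 2 → ℝ}
    (hv : ∀ i, 0 < v i) (h : K.mulVec v = l • v) :
    ∃ C, 0 < C ∧ ∀ n : ℕ, ‖K ^ n‖ ≤ C * l ^ n := by
  obtain ⟨D, hD, hDM⟩ := Matrix.exists_l2_opNorm_le_sum
  have hpow : ∀ n : ℕ, (∀ i j, 0 ≤ (K ^ n) i j) ∧ (K ^ n).mulVec v = l ^ n • v := by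
    intro n
    induction n with
    | zero =>
      refine ⟨fun i j => ?_, by simp⟩
      rw [pow_zero, Matrix.one_apply]
      split <;> norm_num
    | succ n ih =>
      refine ⟨fun i j => ?_, ?_⟩
      · rw [pow_succ, Matrix.mul_apply]
        exact Finset.sum_nonneg fun k _ => mul_nonneg (ih.1 i k) (hK k j)
      · rw [pow_succ, ← Matrix.mulVec_mulVec, h, Matrix.mulVec_smul, ih.2, smul_smul, pow_succ']
  refine ⟨D * ∑ i, ∑ j, v i / v j, ?_, fun n => (hDM _).trans ?_⟩
  · have : ∀ i j, 0 < v i / v j := fun i j => div_pos (hv i) (hv j)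
    exact mul_pos hD (Finset.sum_pos (fun i _ => Finset.sum_pos (fun j _ => this i j)
      Finset.univ_nonempty) Finset.univ_nonempty)
  · rw [mul_assoc, Finset.sum_mul]
    refine mul_le_mul_of_nonneg_left (Finset.sum_le_sum fun i _ => ?_) hD.le
    rw [Finset.sum_mul]
    refine Finset.sum_le_sum fun j _ => ?_
    rw [abs_of_nonneg ((hpow n).1 i j), div_mul_eq_mul_div, le_div_iff₀ (hv j)]
    have h1 := congrFun (hpow n).2 i
    simp only [Matrix.mulVec, dotProduct, Pi.smul_apply, smul_eq_mul] at h1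
    rw [mul_comm (v i), ← h1]
    exact Finset.single_le_sum (f := fun j => (K ^ n) i j * v j)
      (fun j _ => mul_nonneg ((hpow n).1 i j) (hv j).le) (Finset.mem_univ j)

theorem WeaklyExtremal.jointSpecRad_pow_le {B : Fin 2 → Mat2} {x : InfWord}
    (hx : WeaklyExtremal B x) {q : ℕ} (hq : 0 < q) {K : Mat2} (hK : ∀ i j, 0 ≤ K i j) {l : ℝ}
    (hl : 0 < l) {v : Fin 2 → ℝ} (hv : ∀ i, 0 < v i) (h : K.mulVec v = l • v)
    (hper : ∀ n, wordProd B (initialWord x (n * q)) = K ^ n) : jointSpecRad B ^ q ≤ l := by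
  obtain ⟨C, hC, hCn⟩ := exists_norm_pow_le hK hv h
  have h1 : Tendsto (fun n : ℕ => n * q) atTop atTop := tendsto_id.atTop_mul_const' hq
  have h2 := (Tendsto.comp hx h1).pow q
  have h3 : Tendsto (fun n : ℕ => C ^ (1 / (n : ℝ)) * l) atTop (𝓝 (1 * l)) :=
    (tendsto_const_rpow_one_div hC).mul_const l
  rw [one_mul] at h3
  refine le_of_tendsto_of_tendsto h2 h3 ?_
  filter_upwards [eventually_gt_atTop 0] with n hn
  have hn' : (n : ℝ) ≠ 0 := by positivity
  have hq' : (q : ℝ) ≠ 0 := by positivity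
  simp only [Function.comp]
  rw [hper, ← Real.rpow_natCast, ← Real.rpow_mul (norm_nonneg _)]
  have e : 1 / ((n * q : ℕ) : ℝ) * q = 1 / n := by
    push_cast
    field_simp
  rw [e]
  refine (Real.rpow_le_rpow (norm_nonneg _) (hCn n) (by positivity : (0:ℝ) ≤ 1 / n)).trans ?_
  rw [Real.mul_rpow hC.le (by positivity), one_div, Real.pow_rpow_inv_natCast hl.le hn.ne']

/-! ### Determinants against permanents -/

/-- The permanent of a `2 × 2` matrix. -/
def perm2 (M : Mat2) : ℝ := M 0 0 * M 1 1 + M 0 1 * M 1 0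

theorem perm2_nonneg {M : Mat2} (hM : ∀ i j, 0 ≤ M i j) : 0 ≤ perm2 M :=
  add_nonneg (mul_nonneg (hM 0 0) (hM 1 1)) (mul_nonneg (hM 0 1) (hM 1 0))

theorem abs_det_le_perm2 {M : Mat2} (hM : ∀ i j, 0 ≤ M i j) : |M.det| ≤ perm2 M := by
  rw [Matrix.det_fin_two, perm2, abs_le]
  have h1 := mul_nonneg (hM 0 0) (hM 1 1)
  have h2 := mul_nonneg (hM 0 1) (hM 1 0)
  constructor <;> linarith

theorem abs_det_lt_perm2 {M : Mat2} (hM : ∀ i j, 0 < M i j) : |M.det| < perm2 M := by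
  rw [Matrix.det_fin_two, perm2, abs_lt]
  have h1 := mul_pos (hM 0 0) (hM 1 1)
  have h2 := mul_pos (hM 0 1) (hM 1 0)
  constructor <;> linarith

/-- With multiplicativity of det, this makes |det|/perm submultiplicative. For positive matrices
this ratio is tanh of half the projective diameter of the image of the cone. -/
theorem perm2_mul_perm2_le {M N : Mat2} (hM : ∀ i j, 0 ≤ M i j) (hN : ∀ i j, 0 ≤ N i j) :
    perm2 M * perm2 N ≤ perm2 (M * N) := by
  have h1 : 0 ≤ (M 0 0 * M 1 0) * (N 0 0 * N 0 1) :=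
    mul_nonneg (mul_nonneg (hM 0 0) (hM 1 0)) (mul_nonneg (hN 0 0) (hN 0 1))
  have h2 : 0 ≤ (M 0 1 * M 1 1) * (N 1 0 * N 1 1) :=
    mul_nonneg (mul_nonneg (hM 0 1) (hM 1 1)) (mul_nonneg (hN 1 0) (hN 1 1))
  simp only [perm2, Matrix.mul_apply, Fin.sum_univ_two]
  nlinarith

theorem abs_det_mul_le {M N : Mat2} (hM : ∀ i j, 0 ≤ M i j) (hN : ∀ i j, 0 ≤ N i j) {s t : ℝ}
    (hs : 0 ≤ s) (ht : 0 ≤ t) (h1 : |M.det| ≤ s * perm2 M) (h2 : |N.det| ≤ t * perm2 N) :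
    |(M * N).det| ≤ s * t * perm2 (M * N) := by
  rw [Matrix.det_mul, abs_mul]
  calc |M.det| * |N.det| ≤ (s * perm2 M) * (t * perm2 N) := by
        gcongr
        exact mul_nonneg hs (perm2_nonneg hM)
    _ = s * t * (perm2 M * perm2 N) := by ring
    _ ≤ _ := by
        gcongr
        exact perm2_mul_perm2_le hM hN

/-- Submultiplicativity for the matrix with rows y, y' times C: all covectors that factor through C
are almost parallel. -/
theorem abs_cross_vecMul_le {C : Mat2} (hC : ∀ i j, 0 ≤ C i j) {η : ℝ} (hη : 0 ≤ η)
    (h : |C.det| ≤ η * perm2 C) {y y' : Fin 2 → ℝ} (hy : ∀ i, 0 ≤ y i) (hy' : ∀ i, 0 ≤ y' i) :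
    |C.vecMul y 0 * C.vecMul y' 1 - C.vecMul y 1 * C.vecMul y' 0| ≤
      η * (C.vecMul y 0 * C.vecMul y' 1 + C.vecMul y 1 * C.vecMul y' 0) := by
  have hY : ∀ i j, 0 ≤ (Matrix.of ![y, y'] : Mat2) i j := by
    intro i j
    fin_cases i
    · exact hy j
    · exact hy' j
  have := abs_det_mul_le hY hC zero_le_one hη (by simpa using abs_det_le_perm2 hY) h
  simpa [Matrix.det_fin_two, perm2, Matrix.mul_apply, Matrix.vecMul, dotProduct,
    Fin.sum_univ_two] using this

/-- A lower bound for the cross ratio of two nonnegative covectors and two nonnegative vectors. -/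
theorem cross_ratio_le {w w' v v' : Fin 2 → ℝ} (hw : ∀ i, 0 ≤ w i) (hw' : ∀ i, 0 ≤ w' i)
    (hv : ∀ i, 0 ≤ v i) (hv' : ∀ i, 0 ≤ v' i) {η : ℝ} (hη : 0 ≤ η)
    (h : |w 0 * w' 1 - w 1 * w' 0| ≤ η * (w 0 * w' 1 + w 1 * w' 0)) :
    (1 - η) * ((w ⬝ᵥ v) * (w' ⬝ᵥ v')) ≤ (1 + η) * ((w ⬝ᵥ v') * (w' ⬝ᵥ v)) := by
  obtain ⟨h1, h2⟩ := abs_le.1 h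
  have e1 : 0 ≤ (v' 0 * v 1) * ((1 + η) * (w 0 * w' 1) - (1 - η) * (w 1 * w' 0)) :=
    mul_nonneg (mul_nonneg (hv' 0) (hv 1)) (by linarith)
  have e2 : 0 ≤ (v' 1 * v 0) * ((1 + η) * (w 1 * w' 0) - (1 - η) * (w 0 * w' 1)) :=
    mul_nonneg (mul_nonneg (hv' 1) (hv 0)) (by linarith)
  have e3 : 0 ≤ η * ((w 0 * w' 0) * (v 0 * v' 0) + (w 1 * w' 1) * (v 1 * v' 1)) :=
    mul_nonneg hη (add_nonneg
      (mul_nonneg (mul_nonneg (hw 0) (hw' 0)) (mul_nonneg (hv 0) (hv' 0)))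
      (mul_nonneg (mul_nonneg (hw 1) (hw' 1)) (mul_nonneg (hv 1) (hv' 1))))
  simp only [dotProduct, Fin.sum_univ_two]
  linarith

/-! ### Rotation words of rational slope -/

/-- The coding of the rotation by `p` on `ℤ / q` started at `j`. -/
def rotWord (p q j : ℕ) : InfWord := fun i =>
  if (j + i * p) / q < (j + (i + 1) * p) / q then 1 else 0

theorem rotWord_add_div {p q : ℕ} (hq : 0 < q) (hpq : p ≤ q) (j i : ℕ) :
    (j + i * p) / q + (rotWord p q j i : ℕ) = (j + (i + 1) * p) / q := by
  have h1 : (j + i * p) / q ≤ (j + (i + 1) * p) / q := by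
    gcongr
    exact Nat.le_succ i
  have h2 : (j + (i + 1) * p) / q ≤ (j + i * p) / q + 1 := by
    rw [← Nat.add_div_right _ hq]
    refine Nat.div_le_div_right ?_
    rw [add_mul]
    omega
  unfold rotWord
  split
  · simp; omega
  · simp; omega

theorem shiftWord_rotWord (p q j m : ℕ) : shiftWord m (rotWord p q j) = rotWord p q (j + m * p) := by
  funext i
  have e : ∀ k, j + (m + k) * p = j + m * p + k * p := fun k => by ring
  simp only [shiftWord, rotWord]
  rw [e, add_assoc m i 1, e]

theorem rotWord_add_mul {q : ℕ} (hq : 0 < q) (p j s : ℕ) :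
    rotWord p q (j + q * s) = rotWord p q j := by
  funext i
  simp only [rotWord]
  have e : ∀ k, (j + q * s + k) / q = (j + k) / q + s := by
    intro k
    rw [show j + q * s + k = j + k + q * s by ring, Nat.add_mul_div_left _ _ hq]
  rw [e, e]
  simp

theorem count_one_rotWord {p q : ℕ} (hq : 0 < q) (hpq : p ≤ q) (j n : ℕ) :
    j / q + (initialWord (rotWord p q j) n).count 1 = (j + n * p) / q := by
  induction n with
  | zero => simp [initialWord_zero]
  | succ n ih => rw [count_one_initialWord_succ, ← add_assoc, ih, rotWord_add_div hq hpq]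

theorem rotWord_mem_sturmianWords {p q : ℕ} (hq : 0 < q) (hpq : p ≤ q) (j : ℕ) :
    rotWord p q j ∈ SturmianWords ((p : ℝ) / q) := by
  refine ⟨(j : ℝ) / q, Or.inl fun n => ?_⟩
  have hq' : (q : ℝ) ≠ 0 := by positivity
  have e : ∀ n : ℕ, ⌊(p : ℝ) / q * n + j / q⌋ = ((j + n * p) / q : ℕ) := by
    intro n
    rw [← Nat.floor_div_eq_div (K := ℝ), ← Int.natCast_floor_eq_floor (by positivity)]
    congr 2
    push_cast
    field_simp
    ring
  have h1 := e n
  have h2 := e (n + 1)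
  push_cast at h1 h2
  rw [h1, h2]
  have := rotWord_add_div hq hpq j n
  have h3 : ((rotWord p q j n : ℕ) : ℤ) = ((j + (n + 1) * p) / q : ℕ) - ((j + n * p) / q : ℕ) := by
    omega
  push_cast at h3
  exact h3

theorem initialWord_rotWord_add {p q : ℕ} (j m n : ℕ) :
    initialWord (rotWord p q j) (m + n) =
      initialWord (rotWord p q j) m ++ initialWord (rotWord p q (j + m * p)) n := by
  rw [initialWord_add, shiftWord_rotWord]

theorem wordProd_rotWord_mul (B : Fin 2 → Mat2) {q : ℕ} (hq : 0 < q) (p j n : ℕ) :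
    wordProd B (initialWord (rotWord p q j) (n * q)) =
      wordProd B (initialWord (rotWord p q j) q) ^ n := by
  induction n with
  | zero => simp [initialWord_zero, wordProd_nil]
  | succ n ih =>
    rw [add_mul, one_mul, initialWord_rotWord_add, wordProd_append, ih,
      show j + n * q * p = j + q * (n * p) by ring, rotWord_add_mul hq, pow_succ']

/-- The codings started at `p - 1` and at `p` agree in their first `q - 2` letters. -/
theorem initialWord_rotWord_pred {p q : ℕ} (hp : 0 < p) (hcop : Nat.Coprime p q) :
    initialWord (rotWord p q (p - 1)) (q - 2) = initialWord (rotWord p q p) (q - 2) := by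
  refine initialWord_congr fun i hi => ?_
  -- The floors differ only if q divides p(k + 1), hence q ∣ k + 1. Letter i involves k = i and k =
  -- i + 1, whence q − 2.
  have e : ∀ k, k + 1 < q → (p - 1 + k * p) / q = (p + k * p) / q := by
    intro k hk
    have h1 : p + k * p = (p - 1 + k * p) + 1 := by omega
    rw [h1, Nat.succ_div, if_neg, add_zero]
    intro hdvd
    rw [← h1, show p + k * p = p * (k + 1) by ring] at hdvd
    have := Nat.le_of_dvd k.succ_pos (hcop.symm.dvd_of_dvd_mul_left hdvd)
    omega
  simp only [rotWord]
  rw [e i (by omega), e (i + 1) (by omega)]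

/-- Here m₂ is the inverse of p modulo q. In the rotation, m₁ steps lead from p to p − 1 and m₂
steps lead back. -/
theorem exists_bezout {p q : ℕ} (hp : 0 < p) (hpq : p < q) (hcop : Nat.Coprime p q) :
    ∃ m₁ m₂ p₁ p₂ : ℕ, m₁ + m₂ = q ∧ q * p₁ = m₁ * p + 1 ∧ q * p₂ + 1 = m₂ * p := by
  obtain ⟨m, hm, hmod⟩ := Nat.exists_mul_mod_eq_one_of_coprime hcop (by omega)
  have h1 := Nat.div_add_mod (p * m) q
  rw [hmod] at h1
  refine ⟨q - m, m, p - p * m / q, p * m / q, by omega, ?_, by linarith⟩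
  have h2 : p * m / q ≤ p := by
    refine Nat.div_le_of_le_mul ?_
    nlinarith
  zify [h2, hm.le] at h1 ⊢
  linear_combination -h1

/-! ### Length of a level set of rational ratio -/

section Estimate

variable {A : Fin 2 → Mat2} {r : ℝ≥0 → Set.Icc (0 : ℝ) 1}

theorem TechnicalHypotheses.wordProd_pos (hA : TechnicalHypotheses A) {u : FinWord}
    (h0 : u.count 1 ≠ 0) (h1 : u.count 1 ≠ u.length) (i j : Fin 2) : 0 < wordProd A u i j := by
  refine hA.mixed_pos u (fun n hn => h0 ?_) (fun n hn => h1 ?_) i j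
  · rw [hn, List.count_replicate]
    simp
  · rw [hn]
    simp

/-- Mixed products are positive, so |det| < perm strictly, and only finitely many words have length
k. -/
theorem TechnicalHypotheses.exists_abs_det_le (hA : TechnicalHypotheses A) (k : ℕ) :
    ∃ τ : ℝ, 0 < τ ∧ τ < 1 ∧ ∀ u : FinWord, u.length = k → u.count 1 ≠ 0 →
      u.count 1 ≠ u.length → |(wordProd A u).det| ≤ τ * perm2 (wordProd A u) := by
  have hev : ∀ᶠ τ : ℝ in 𝓝[<] 1, ∀ u ∈ {u : FinWord | u.length ≤ k}, u.count 1 ≠ 0 →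
      u.count 1 ≠ u.length → |(wordProd A u).det| ≤ τ * perm2 (wordProd A u) := by
    rw [(finite_setOf_length_le k).eventually_all]
    intro u _
    by_cases h : u.count 1 ≠ 0 ∧ u.count 1 ≠ u.length
    · have hlt := abs_det_lt_perm2 (hA.wordProd_pos h.1 h.2)
      have hpos : 0 < perm2 (wordProd A u) := (abs_nonneg _).trans_lt hlt
      filter_upwards [mem_nhdsWithin_of_mem_nhds (lt_mem_nhds ((div_lt_one hpos).2 hlt))]
        with τ hτ _ _
      exact ((div_lt_iff₀ hpos).1 hτ).le
    · exact Eventually.of_forall fun τ h0 h1 => absurd ⟨h0, h1⟩ h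
  obtain ⟨τ, h1, h2, h3⟩ := (hev.and ((eventually_nhdsWithin_of_eventually_nhds
    (lt_mem_nhds one_pos)).and eventually_mem_nhdsWithin)).exists
  exact ⟨τ, h2, h3, fun u hu => h1 u (le_of_eq hu)⟩

/-- The conditions on k say kp/q ≥ 1 and k(1 − p/q) ≥ 1, so each block of length k contains both
letters and contributes a factor τ. -/
theorem TechnicalHypotheses.abs_det_rotWord_le (hA : TechnicalHypotheses A) {k : ℕ} {τ : ℝ}
    (hτ : 0 < τ) (h : ∀ u : FinWord, u.length = k → u.count 1 ≠ 0 →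
      u.count 1 ≠ u.length → |(wordProd A u).det| ≤ τ * perm2 (wordProd A u))
    {p q : ℕ} (hq : 0 < q) (hpq : p ≤ q) (h1 : q ≤ k * p) (h2 : k * p + q ≤ k * q) (n s j : ℕ) :
    |(wordProd A (initialWord (rotWord p q j) (n * k + s))).det| ≤
      τ ^ n * perm2 (wordProd A (initialWord (rotWord p q j) (n * k + s))) := by
  induction n generalizing j with
  | zero => simpa using abs_det_le_perm2 (wordProd_nonneg hA.nonneg _)
  | succ n ih =>
    rw [show (n + 1) * k + s = k + (n * k + s) by ring, initialWord_rotWord_add, wordProd_append,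
      pow_succ]
    refine abs_det_mul_le (wordProd_nonneg hA.nonneg _) (wordProd_nonneg hA.nonneg _)
      (by positivity) hτ.le (ih _) (h _ (length_initialWord _ _) ?_ ?_)
    · have e1 := count_one_rotWord hq hpq j k
      have e2 : j / q + 1 ≤ (j + k * p) / q := by
        rw [← Nat.add_div_right _ hq]
        gcongr
      omega
    · rw [length_initialWord]
      have e1 := count_one_rotWord hq hpq j k
      have e2 : (j + k * p) / q + 1 ≤ j / q + k := by
        rw [← Nat.add_div_right _ hq, ← Nat.add_mul_div_right _ _ hq]
        exact Nat.div_le_div_right (by omega)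
      omega

/-- Insertion of a word into the extremal periodic word: the scaled form. -/
theorem IsOneRatioFunction.pow_mul_dotProduct_le (hA : TechnicalHypotheses A)
    (hr : IsOneRatioFunction A r) {p q : ℕ} (hp : 0 < p) (hpq : p < q) {α : ℝ≥0} (hα : 0 < α)
    (hrα : (r α : ℝ) = (p : ℝ) / q) {l : ℝ} {v w : Fin 2 → ℝ} (hl : 0 < l) (hv : ∀ i, 0 < v i)
    (hw : ∀ i, 0 < w i) (hKv : (wordProd A (initialWord (rotWord p q p) q)).mulVec v = l • v)
    (hlim : ∀ z, Tendsto (fun N : ℕ =>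
      (l⁻¹) ^ N • (wordProd A (initialWord (rotWord p q p) q) ^ N).mulVec z) atTop
        (𝓝 (((w ⬝ᵥ z) / (w ⬝ᵥ v)) • v))) (T : FinWord) :
    ((α : ℝ) ^ T.count 1 * ((w ⬝ᵥ (wordProd A T).mulVec v) / (w ⬝ᵥ v))) ^ q ≤
      (l * (α : ℝ) ^ p) ^ T.length := by
  have hq : 0 < q := hp.trans hpq
  have hα' : (0 : ℝ) < α := hα
  obtain ⟨a, ha, hB⟩ := hA.exists_pow_le_norm_pow 0
  set U := initialWord (rotWord p q p) q with hU
  have hcount : U.count 1 = p := by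
    have h1 := count_one_rotWord hq hpq.le p q
    rw [Nat.div_eq_of_lt hpq, zero_add, ← hU, Nat.add_mul_div_left _ _ hq, Nat.div_eq_of_lt hpq,
      zero_add] at h1
    exact h1
  have hUl : U.length = q := length_initialWord _ _
  have hB0 : ∀ k i j, 0 ≤ scaledPair A α k i j := by
    intro k i j
    fin_cases k
    · exact hA.nonneg 0 i j
    · exact mul_nonneg hα'.le (hA.nonneg 1 i j)
  have hKα : wordProd (scaledPair A α) U = (α : ℝ) ^ p • wordProd A U := by
    rw [wordProd_scaledPair, hcount]
  have hlα : 0 < l * (α : ℝ) ^ p := by positivity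
  have hle : jointSpecRad (scaledPair A α) ^ q ≤ l * (α : ℝ) ^ p := by
    have hx := rotWord_mem_sturmianWords hq hpq.le p
    rw [← hrα] at hx
    refine (hr.extremal α _ hx).jointSpecRad_pow_le hq (wordProd_nonneg hB0 U) hlα hv ?_
      (wordProd_rotWord_mul _ hq p p)
    rw [hKα, Matrix.smul_mulVec, hKv, smul_smul, mul_comm]
  -- The factor α^p cancels: the Perron vectors of the unscaled product serve every α in the level
  -- set.
  have hlim' : ∀ z, Tendsto (fun N : ℕ =>
      ((l * (α : ℝ) ^ p)⁻¹) ^ N • (wordProd (scaledPair A α) U ^ N).mulVec z) atTop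
        (𝓝 (((w ⬝ᵥ z) / (w ⬝ᵥ v)) • v)) := by
    intro z
    refine (hlim z).congr fun N => ?_
    rw [hKα, smul_pow, Matrix.smul_mulVec, smul_smul, ← mul_pow, mul_inv, mul_assoc,
      inv_mul_cancel₀ (by positivity), mul_one]
  have hwv : 0 < w ⬝ᵥ v := by
    rw [dotProduct, Fin.sum_univ_two]
    exact add_pos (mul_pos (hw 0) (hv 0)) (mul_pos (hw 1) (hv 1))
  have hmain := dotProduct_mulVec_le (B := scaledPair A α) hB0 ha hB (by omega) hlα hv hw hlim'
    (by rwa [hUl]) T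
  rw [wordProd_scaledPair, Matrix.smul_mulVec, dotProduct_smul, smul_eq_mul, ← div_le_iff₀ hwv,
    mul_div_assoc] at hmain
  have hnn : 0 ≤ (α : ℝ) ^ T.count 1 * ((w ⬝ᵥ (wordProd A T).mulVec v) / (w ⬝ᵥ v)) := by
    refine mul_nonneg (by positivity) (div_nonneg ?_ hwv.le)
    exact dotProduct_nonneg_of_nonneg (fun i => (hw i).le)
      (mulVec_nonneg (wordProd_nonneg hA.nonneg T) fun j => (hv j).le)
  calc _ ≤ (jointSpecRad (scaledPair A α) ^ T.length) ^ q := pow_le_pow_left₀ hnn hmain q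
    _ = (jointSpecRad (scaledPair A α) ^ q) ^ T.length := by rw [← pow_mul, ← pow_mul, mul_comm]
    _ ≤ _ := pow_le_pow_left₀ (pow_nonneg (hA.jointSpecRad_pos _).le _) hle _

/-- Eliminates κ and κ' between the insertion bounds at the two parameters a, b and the cross ratio
estimate, which says l/(κκ') ≤ (1 + η)/(1 − η) when η < 1. -/
theorem IsOneRatioFunction.mul_pow_le (hA : TechnicalHypotheses A)
    (hr : IsOneRatioFunction A r) {p q : ℕ} (hp : 0 < p) (hpq : p < q) (hcop : Nat.Coprime p q)
    {a b : ℝ≥0} (ha : 0 < a) (hb : 0 < b) (hra : (r a : ℝ) = (p : ℝ) / q)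
    (hrb : (r b : ℝ) = (p : ℝ) / q) {η : ℝ} (hη : 0 ≤ η) (hη1 : η ≤ 1)
    (hdet : |(wordProd A (initialWord (rotWord p q p) (q - 2))).det| ≤
      η * perm2 (wordProd A (initialWord (rotWord p q p) (q - 2)))) :
    (b : ℝ) * (1 - η) ^ q ≤ a * (1 + η) ^ q := by
  have hq : 0 < q := hp.trans hpq
  have ha' : (0 : ℝ) < a := ha
  have hb' : (0 : ℝ) < b := hb
  obtain ⟨m₁, m₂, p₁, p₂, hm, hp1, hp2⟩ := exists_bezout hp hpq hcop
  set T := initialWord (rotWord p q p) m₁ with hT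
  set T' := initialWord (rotWord p q (p - 1)) m₂ with hT'
  have hTl : T.length = m₁ := length_initialWord _ _
  have hTl' : T'.length = m₂ := length_initialWord _ _
  have hU : initialWord (rotWord p q p) q = T ++ T' := by
    rw [← hm, initialWord_rotWord_add, hm, show p + m₁ * p = p - 1 + q * p₁ by omega,
      rotWord_add_mul hq]
  have hU' : initialWord (rotWord p q (p - 1)) q = T' ++ T := by
    rw [← hm, add_comm m₁, initialWord_rotWord_add, add_comm m₂, hm,
      show p - 1 + m₂ * p = p + q * p₂ by omega, rotWord_add_mul hq]
  have hTc : T.count 1 = p₁ := by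
    have := count_one_rotWord hq hpq.le p m₁
    rw [Nat.div_eq_of_lt hpq, zero_add, show p + m₁ * p = p - 1 + q * p₁ by omega,
      Nat.add_mul_div_left _ _ hq, Nat.div_eq_of_lt (by omega), zero_add] at this
    exact this
  have hTc' : T'.count 1 = p₂ := by
    have := count_one_rotWord hq hpq.le (p - 1) m₂
    rw [Nat.div_eq_of_lt (by omega), zero_add, show p - 1 + m₂ * p = p + q * p₂ by omega,
      Nat.add_mul_div_left _ _ hq, Nat.div_eq_of_lt hpq, zero_add] at this
    exact this
  set M := wordProd A T with hM
  set M' := wordProd A T' with hM'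
  have hK : wordProd A (initialWord (rotWord p q p) q) = M' * M := by rw [hU, wordProd_append]
  have hK' : wordProd A (initialWord (rotWord p q (p - 1)) q) = M * M' := by
    rw [hU', wordProd_append]
  have hKpos : ∀ i j, 0 < wordProd A (initialWord (rotWord p q p) q) i j := by
    have hcount : (initialWord (rotWord p q p) q).count 1 = p := by
      have h1 := count_one_rotWord hq hpq.le p q
      rwa [Nat.div_eq_of_lt hpq, zero_add, Nat.add_mul_div_left _ _ hq, Nat.div_eq_of_lt hpq,
        zero_add] at h1
    refine hA.wordProd_pos ?_ ?_
    · omega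
    · rw [hcount, length_initialWord]
      omega
  obtain ⟨l, v, w, hl, hv, hw, hKv, hwK, hlim⟩ := exists_perron hKpos
  -- T has slightly too many 1s and so is tested at b; T' has slightly too few and is tested at a.
  have h1 := hr.pow_mul_dotProduct_le hA hp hpq hb hrb hl hv hw hKv hlim T
  have h2 := hr.pow_mul_dotProduct_le hA hp hpq ha hra hl hv hw hKv hlim T'
  rw [← hM, hTc, hTl] at h1
  rw [← hM', hTc', hTl'] at h2
  have hwv : 0 < w ⬝ᵥ v := by
    rw [dotProduct, Fin.sum_univ_two]
    exact add_pos (mul_pos (hw 0) (hv 0)) (mul_pos (hw 1) (hv 1))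
  have hMnn : ∀ i j, 0 ≤ M i j := wordProd_nonneg hA.nonneg T
  have hMnn' : ∀ i j, 0 ≤ M' i j := wordProd_nonneg hA.nonneg T'
  have hv' := mulVec_nonneg hMnn fun i => (hv i).le
  have hw' := vecMul_nonneg hMnn' fun i => (hw i).le
  -- the two left eigenvectors have a long common right factor
  have hcross : |w 0 * M'.vecMul w 1 - w 1 * M'.vecMul w 0| ≤
      η * (w 0 * M'.vecMul w 1 + w 1 * M'.vecMul w 0) := by
    set C := wordProd A (initialWord (rotWord p q p) (q - 2)) with hC
    have hsplit : q - 2 + 2 = q := by omega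
    obtain ⟨E, hE, hEC⟩ : ∃ E : Mat2, (∀ i j, 0 ≤ E i j) ∧ M' * M = E * C := by
      refine ⟨wordProd A (initialWord (shiftWord (q - 2) (rotWord p q p)) 2),
        wordProd_nonneg hA.nonneg _, ?_⟩
      rw [← hK, hC, ← wordProd_append, ← initialWord_add, hsplit]
    obtain ⟨E', hE', hEC'⟩ : ∃ E : Mat2, (∀ i j, 0 ≤ E i j) ∧ M * M' = E * C := by
      refine ⟨wordProd A (initialWord (shiftWord (q - 2) (rotWord p q (p - 1))) 2),
        wordProd_nonneg hA.nonneg _, ?_⟩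
      rw [← hK', hC, ← initialWord_rotWord_pred hp hcop, ← wordProd_append, ← initialWord_add,
        hsplit]
    have e1 : C.vecMul (E.vecMul w) = l • w := by
      rw [Matrix.vecMul_vecMul, ← hEC, ← hK, hwK]
    have e2 : C.vecMul (E'.vecMul (M'.vecMul w)) = l • M'.vecMul w := by
      rw [Matrix.vecMul_vecMul, ← hEC', Matrix.vecMul_vecMul, ← mul_assoc, ← Matrix.vecMul_vecMul,
        ← hK, hwK, Matrix.smul_vecMul]
    have := abs_cross_vecMul_le (wordProd_nonneg hA.nonneg _) hη hdet
      (vecMul_nonneg hE fun i => (hw i).le) (vecMul_nonneg hE' hw')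
    rw [e1, e2] at this
    simp only [Pi.smul_apply, smul_eq_mul] at this
    rw [show l * w 0 * (l * M'.vecMul w 1) - l * w 1 * (l * M'.vecMul w 0) =
      l ^ 2 * (w 0 * M'.vecMul w 1 - w 1 * M'.vecMul w 0) by ring, abs_mul,
      abs_of_pos (by positivity : 0 < l ^ 2)] at this
    refine le_of_mul_le_mul_left (this.trans (le_of_eq ?_)) (by positivity : 0 < l ^ 2)
    ring
  have hcr := cross_ratio_le (fun i => (hw i).le) hw' (fun i => (hv i).le) hv' hη hcross
  -- Since wM' · Mv = w · Kv = l (w · v), the eigenvalue enters the cross ratio.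
  rw [← Matrix.dotProduct_mulVec w M', ← Matrix.dotProduct_mulVec w M', Matrix.mulVec_mulVec, ← hK,
    hKv, dotProduct_smul, smul_eq_mul] at hcr
  set κ := (w ⬝ᵥ M.mulVec v) / (w ⬝ᵥ v) with hκ
  set κ' := (w ⬝ᵥ M'.mulVec v) / (w ⬝ᵥ v) with hκ'
  have hκ0 : 0 ≤ κ := div_nonneg (dotProduct_nonneg_of_nonneg (fun i => (hw i).le) hv') hwv.le
  have hκ0' : 0 ≤ κ' := div_nonneg (dotProduct_nonneg_of_nonneg (fun i => (hw i).le)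
    (mulVec_nonneg hMnn' fun j => (hv j).le)) hwv.le
  have hcr' : (1 - η) * l ≤ (1 + η) * (κ * κ') := by
    rw [hκ, hκ', div_mul_div_comm, mul_div_assoc', le_div_iff₀ (by positivity)]
    linarith
  -- Bézout, q p₁ = m₁ p + 1, leaves exactly one power of b.
  have h3 : b * κ ^ q ≤ l ^ m₁ := by
    rw [mul_pow, ← pow_mul, mul_comm p₁, hp1, mul_pow, ← pow_mul, mul_comm p, pow_succ] at h1
    refine le_of_mul_le_mul_left ?_ (by positivity : (0 : ℝ) < (b : ℝ) ^ (m₁ * p))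
    linarith
  have h4 : κ' ^ q ≤ l ^ m₂ * a := by
    rw [mul_pow, ← pow_mul, mul_comm p₂, mul_pow, ← pow_mul, mul_comm p, ← hp2, pow_succ] at h2
    refine le_of_mul_le_mul_left ?_ (by positivity : (0 : ℝ) < (a : ℝ) ^ (q * p₂))
    linarith
  have h5 : b * (κ * κ') ^ q ≤ l ^ q * a := by
    calc b * (κ * κ') ^ q = (b * κ ^ q) * κ' ^ q := by ring
      _ ≤ l ^ m₁ * (l ^ m₂ * a) := by gcongr
      _ = l ^ q * a := by rw [← hm, pow_add]; ring
  have h6 : ((1 - η) * l) ^ q ≤ ((1 + η) * (κ * κ')) ^ q :=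
    pow_le_pow_left₀ (mul_nonneg (by linarith) hl.le) hcr' q
  refine le_of_mul_le_mul_right ?_ (by positivity : 0 < l ^ q)
  calc (b : ℝ) * (1 - η) ^ q * l ^ q = b * ((1 - η) * l) ^ q := by rw [mul_pow]; ring
    _ ≤ b * ((1 + η) * (κ * κ')) ^ q := by gcongr
    _ = (1 + η) ^ q * (b * (κ * κ') ^ q) := by rw [mul_pow (1 + η)]; ring
    _ ≤ (1 + η) ^ q * (l ^ q * a) := by gcongr
    _ = _ := by ring

/-- Bernoulli's inequality for ((1 − η)/(1 + η))^q. -/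
theorem sub_le_of_mul_pow_le {a b η : ℝ} (hb : 0 ≤ b) (hη : 0 ≤ η) {q : ℕ}
    (h : b * (1 - η) ^ q ≤ a * (1 + η) ^ q) : b - a ≤ b * (2 * q * η) := by
  have h1 : (1 - η) / (1 + η) = 1 + -(2 * η / (1 + η)) := by
    field_simp
    ring
  have h2 : 2 * η / (1 + η) ≤ 2 * η := div_le_self (by positivity) (by linarith)
  have h3 : 2 * η / (1 + η) ≤ 2 := by
    rw [div_le_iff₀ (by positivity)]
    linarith
  have h4 := one_add_mul_le_pow (a := -(2 * η / (1 + η))) (by linarith) q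
  rw [← h1, div_pow] at h4
  have h5 : b * ((1 - η) ^ q / (1 + η) ^ q) ≤ a := by
    rw [mul_div_assoc', div_le_iff₀ (by positivity)]
    exact h
  have h6 : (q : ℝ) * (2 * η / (1 + η)) ≤ q * (2 * η) := by gcongr
  have h7 := mul_le_mul_of_nonneg_left h4 hb
  have h8 := mul_le_mul_of_nonneg_left h6 hb
  linarith

end Estimate

/-! ### Uniform constants over a compact set of slopes -/

theorem exists_bounds_of_isCompact {L : Set ℝ} (hL : IsCompact L) (hL01 : L ⊆ Set.Ioo 0 1) :
    ∃ ε : ℝ, 0 < ε ∧ ε < 1 ∧ ∀ x ∈ L, ε ≤ x ∧ x ≤ 1 - ε := by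
  rcases L.eq_empty_or_nonempty with rfl | hne
  · exact ⟨1 / 2, by norm_num, by norm_num, fun x hx => hx.elim⟩
  · obtain ⟨s, hs, hs'⟩ := hL.exists_isLeast hne
    obtain ⟨t, ht, ht'⟩ := hL.exists_isGreatest hne
    refine ⟨min s (1 - t), lt_min (hL01 hs).1 (by linarith [(hL01 ht).2]),
      (min_le_left _ _).trans_lt (hL01 hs).2, fun x hx => ⟨(min_le_left _ _).trans (hs' hx), ?_⟩⟩
    have := min_le_right s (1 - t)
    linarith [ht' hx]

theorem corollary6 (A : Fin 2 → Mat2) (hA : TechnicalHypotheses A)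
    (r : ℝ≥0 → Set.Icc (0 : ℝ) 1) (hr : IsOneRatioFunction A r)
    (L : Set ℝ) (hL : IsCompact L) (hL01 : L ⊆ Set.Ioo 0 1) :
    ∃ C θ : ℝ, 1 < C ∧ 0 < θ ∧ θ < 1 ∧
      ∀ p q : ℕ, 0 < q → Nat.Coprime p q → (p : ℝ) / (q : ℝ) ∈ L →
        ∃ a b : ℝ≥0, a ≤ b ∧
          {α : ℝ≥0 | (r α : ℝ) = (p : ℝ) / (q : ℝ)} = Set.Icc a b ∧
          (b : ℝ) - (a : ℝ) ≤ C * (q : ℝ) * θ ^ q := by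
  obtain ⟨ε, hε, hε1, hLε⟩ := exists_bounds_of_isCompact hL hL01
  obtain ⟨c, hc⟩ := hr.exists_le_of_le hA (γ := 1 - ε) (by linarith)
  obtain ⟨k, hk⟩ := exists_nat_ge (1 / ε)
  rw [div_le_iff₀ hε] at hk
  have hk0 : k ≠ 0 := by
    rintro rfl
    norm_num at hk
  obtain ⟨τ, hτ0, hτ1, hτ⟩ := hA.exists_abs_det_le k
  set θ := τ ^ (1 / (k : ℝ)) with hθ
  have hθ0 : 0 < θ := Real.rpow_pos_of_pos hτ0 _
  have hθ1 : θ < 1 := Real.rpow_lt_one hτ0.le hτ1 (by positivity)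
  have hθk : θ ^ k = τ := by rw [hθ, one_div, Real.rpow_inv_natCast_pow hτ0.le hk0]
  -- The summand 2 only ensures C > 1; θ^(k+2) pays for the two last letters and for rounding (q −
  -- 2)/k down.
  refine ⟨2 + 2 * c / θ ^ (k + 2), θ, ?_, hθ0, hθ1, fun p q hq hcop hpqL => ?_⟩
  · have : 0 ≤ 2 * c / θ ^ (k + 2) := by positivity
    linarith
  have hq' : (0 : ℝ) < q := by exact_mod_cast hq
  obtain ⟨h0, h1⟩ := hL01 hpqL
  obtain ⟨hε2, hε3⟩ := hLε _ hpqL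
  have hp : 0 < p := by
    rcases Nat.eq_zero_or_pos p with rfl | hp
    · simp at h0
    · exact hp
  have hpq : p < q := by
    rw [div_lt_one hq'] at h1
    exact_mod_cast h1
  obtain ⟨a, b, ha, hab, hIcc⟩ := hr.exists_eq_Icc hA h0 h1
  refine ⟨a, b, hab, hIcc, ?_⟩
  have hra : (r a : ℝ) = p / q := hIcc.symm.subset (Set.left_mem_Icc.2 hab)
  have hrb : (r b : ℝ) = p / q := hIcc.symm.subset (Set.right_mem_Icc.2 hab)
  rw [le_div_iff₀ hq'] at hε2
  rw [div_le_iff₀ hq'] at hε3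
  have hk1 : q ≤ k * p := by
    have : (q : ℝ) ≤ k * p := by nlinarith [Nat.cast_nonneg (α := ℝ) k]
    exact_mod_cast this
  have hk2 : k * p + q ≤ k * q := by
    have : (k * p + q : ℝ) ≤ k * q := by nlinarith [Nat.cast_nonneg (α := ℝ) k]
    exact_mod_cast this
  have hdet := hA.abs_det_rotWord_le hτ0 hτ hq hpq.le hk1 hk2 ((q - 2) / k) ((q - 2) % k) p
  rw [Nat.div_add_mod'] at hdet
  have hmain := sub_le_of_mul_pow_le b.2 (pow_nonneg hτ0.le _)
    (hr.mul_pow_le hA hp hpq hcop ha (ha.trans_le hab) hra hrb (pow_nonneg hτ0.le _)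
      (pow_le_one₀ hτ0.le hτ1.le) hdet)
  have hbc : (b : ℝ) ≤ c := hc b (by rw [hrb, div_le_iff₀ hq']; exact hε3)
  have hτθ : τ ^ ((q - 2) / k) ≤ θ ^ q / θ ^ (k + 2) := by
    rw [le_div_iff₀ (by positivity), ← hθk, ← pow_mul, ← pow_add]
    refine pow_le_pow_of_le_one hθ0.le hθ1.le ?_
    have := Nat.div_add_mod (q - 2) k
    have := Nat.mod_lt (q - 2) (Nat.pos_of_ne_zero hk0)
    omega
  calc (b : ℝ) - a ≤ b * (2 * q * τ ^ ((q - 2) / k)) := hmain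
    _ ≤ c * (2 * q * (θ ^ q / θ ^ (k + 2))) := by gcongr
    _ = 2 * c / θ ^ (k + 2) * q * θ ^ q := by ring
    _ ≤ (2 + 2 * c / θ ^ (k + 2)) * q * θ ^ q := by
        gcongr
        linarith
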